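/- **Theorem (Lieb–Robinson bound for lattice fermions).** Let $\Gamma$ be a countable set equipped with a metric, and let $\mathcal A_\Gamma=\mathrm{CAR}(\ell^2(\Gamma))$ be the C*-algebra generated by operators $a_x,a_x^*$ $(x\in\Gamma)$ with $\{a_x,a_y\}=\{a_x^*,a_y^*\}=0$ and $\{a_x,a_y^*\}=\delta_{x,y}\mathbb 1$, acting on the antisymmetric Fock space over $\ell^2(\Gamma)$; here $\{A,B\}=AB+BA$ and $[A,B]=AB-BA$. For $X\subset\Gamma$ let $\mathcal A_X$ be the C*-subalgebra generated by $a_x,a_x^*$, $x\in X$. For finite $X$ let $N_X=\sum_{x\in X}a_x^*a_x$ and $\mathcal A_X^+=\{A\in\mathcal A_X:(-1)^{N_X}A(-1)^{N_X}=A\}$. Write $\mathcal P_0(\Gamma)$ for the set of finite subsets of $\Gamma$. Let $G:\Gamma\times\Gamma\to(0,\infty)$ satisfy $G(x,y)=G(y,x)$ and $\sum_{z\in\Gamma}G(x,z)G(z,y)\le G(x,y)$ for all $x,y\in\Gamma$, and $\sup_{x\in\Gamma}\sum_{z\in\Gamma}G(x,z)<\infty$. Let $I\subset\mathbb R$ be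 an interval, and let $\Phi$ be an even, time-dependent interaction: for every $Z\in\mathcal P_0(\Gamma)$ and $t\in I$, $\Phi(Z,t)=\Phi(Z,t)^*\in\mathcal A_Z^+$, and $t\mapsto\Phi(Z,t)$ is norm continuous on $I$. Assume $\Phi\in\mathcal B_G^+(I)$, that is, there is a locally integrable function $\|\Phi\|_G:I\to[0,\infty)$ with $$\sum_{Z\in\mathcal P_0(\Gamma),\ x,y\in Z}\|\Phi(Z,t)\|\le\|\Phi\|_G(t)\,G(x,y)\qquad\text{for all }x,y\in\Gamma,\ t\in I,$$ and fix any such function $\|\Phi\|_G$. For $\Lambda\in\mathcal P_0(\Gamma)$ let $H_\Lambda(t)=\sum_{Z\subset\Lambda}\Phi(Z,t)$, let $U_\Lambda(t,s)$, $s,t\in I$, be the solution of $\frac{d}{dt}U_\Lambda(t,s)=-iH_\Lambda(t)U_\Lambda(t,s)$, $U_\Lambda(s,s)=\mathbb 1$, and let $\tau^\Lambda_{t,s}(A)=U_\Lambda(t,s)^*A\,U_\Lambda(t,s)$. For $X\in\mathcal P_0(\Gamma)$ let $\partial_\Phi X$ be the set of those $x\in X$ for which there are $t\in I$ and $Z\in\mathcal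 P_0(\Gamma)$ with $x\in Z$, $Z\cap(\Gamma\setminus X)\ne\emptyset$ and $\Phi(Z,t)\neq0$. Let $X,Y\subset\Lambda$ with $X\cap Y=\emptyset$, and let $A\in\mathcal A_X$ and $B\in\mathcal A_Y$. (i) If $[A,B]=0$, then for all $s,t\in I$ with $s\le t$, $$\big\|[\tau^\Lambda_{t,s}(A),B]\big\|\le2\|A\|\|B\|\Big(\exp\Big[2\int_s^t\|\Phi\|_G(r)\,dr\Big]-1\Big)\sum_{x\in\partial_\Phi X}\sum_{y\in Y}G(x,y).$$ (ii) If $\{A,B\}=0$, then for all $s,t\in I$ with $s\le t$, $$\big\|\{\tau^\Lambda_{t,s}(A),B\}\big\|\le2\|A\|\|B\|\Big(\exp\Big[2\int_s^t\|\Phi\|_G(r)\,dr\Big]-1\Big)\sum_{x\in\partial_\Phi X}\sum_{y\in Y}G(x,y).$$ -/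

import Mathlib

open scoped ENNReal

/-- The antisymmetric Fock space over `ℓ²(Γ)` in occupation number form: the basis vector labelled by
a finite set `S = {x₁ < ⋯ < xₙ}` of sites is `δ_{x₁} ∧ ⋯ ∧ δ_{xₙ}`. -/
abbrev FockSpace (Γ : Type*) : Type _ := lp (fun _ : Finset Γ => ℂ) 2

/-- Bounded operators on the Fock space. -/
abbrev FockOp (Γ : Type*) : Type _ := FockSpace Γ →L[ℂ] FockSpace Γ

open scoped Classical in
/-- The sign `(-1)^{#{y ∈ S : y < x}}` for a fixed well-ordering `<` of the sites. -/
noncomputable def fockSign {Γ : Type*} (x : Γ) (S : Finset Γ) : ℂ :=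
  (-1) ^ (S.filter (fun y => WellOrderingRel y x)).card

theorem norm_fockSign {Γ : Type*} (x : Γ) (S : Finset Γ) : ‖fockSign x S‖ = 1 := by
  simp [fockSign]

open scoped Classical in
/-- Coordinates of `a_x f`: the basis vector `S ∪ {x}` with `x ∉ S` is sent to `± S`, and basis
vectors not containing `x` are sent to `0`. -/
noncomputable def annihilateFun {Γ : Type*} (x : Γ) (f : Finset Γ → ℂ) (S : Finset Γ) : ℂ :=
  if x ∈ S then 0 else fockSign x S * f (insert x S)

theorem sum_annihilateFun_le {Γ : Type*} (x : Γ) (f : FockSpace Γ) (s : Finset (Finset Γ)) :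
    ∑ S ∈ s, ‖annihilateFun x f S‖ ^ (2 : ℝ≥0∞).toReal ≤ ‖f‖ ^ (2 : ℝ≥0∞).toReal := by
  classical
  have h2 : 0 < (2 : ℝ≥0∞).toReal := by norm_num
  have hinj : Set.InjOn (fun S : Finset Γ => insert x S)
      (↑(s.filter (fun S => x ∉ S)) : Set (Finset Γ)) := by
    intro S hS T hT h
    have hS' : x ∉ S := (Finset.mem_filter.1 hS).2
    have hT' : x ∉ T := (Finset.mem_filter.1 hT).2
    have h' : insert x S = insert x T := h
    rw [← Finset.erase_insert hS', ← Finset.erase_insert hT', h']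
  calc ∑ S ∈ s, ‖annihilateFun x f S‖ ^ (2 : ℝ≥0∞).toReal
      = ∑ S ∈ s.filter (fun S => x ∉ S), ‖f (insert x S)‖ ^ (2 : ℝ≥0∞).toReal := by
        rw [Finset.sum_filter]
        refine Finset.sum_congr rfl fun S _ => ?_
        by_cases hx : x ∈ S
        · simp [annihilateFun, hx]
        · simp [annihilateFun, hx, norm_fockSign]
    _ = ∑ T ∈ (s.filter (fun S => x ∉ S)).image (fun S => insert x S),
          ‖f T‖ ^ (2 : ℝ≥0∞).toReal := by
        rw [Finset.sum_image hinj]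
    _ ≤ ‖f‖ ^ (2 : ℝ≥0∞).toReal := lp.sum_rpow_le_norm_rpow h2 f _

theorem memℓp_annihilateFun {Γ : Type*} (x : Γ) (f : FockSpace Γ) :
    Memℓp (annihilateFun x f) 2 :=
  memℓp_gen' (C := ‖f‖ ^ (2 : ℝ≥0∞).toReal) fun s => sum_annihilateFun_le x f s

/-- The annihilation operator `a_x` on the Fock space. -/
noncomputable def annihilate {Γ : Type*} (x : Γ) : FockOp Γ :=
  LinearMap.mkContinuous
    { toFun := fun f => ⟨annihilateFun x f, memℓp_annihilateFun x f⟩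
      map_add' := fun f g => by
        ext S
        change annihilateFun x (f + g : FockSpace Γ) S = annihilateFun x f S + annihilateFun x g S
        by_cases hx : x ∈ S <;> simp [annihilateFun, hx, mul_add]
      map_smul' := fun c f => by
        ext S
        by_cases hx : x ∈ S <;> simp [annihilateFun, hx, mul_left_comm] }
    1
    (fun f => by
      rw [one_mul]
      exact lp.norm_le_of_forall_sum_le (by norm_num) (norm_nonneg f)
        fun s => sum_annihilateFun_le x f s)

/-- The creation operator `a_x^*`, the Hilbert space adjoint of `a_x`. -/
noncomputable def create {Γ : Type*} (x : Γ) : FockOp Γ := star (annihilate x)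

theorem annihilate_apply {Γ : Type*} (x : Γ) (f : FockSpace Γ) (S : Finset Γ) :
    annihilate x f S = annihilateFun x f S := rfl

open scoped Classical in
theorem create_apply {Γ : Type*} (x : Γ) (f : FockSpace Γ) (S : Finset Γ) :
    create x f S = if x ∈ S then fockSign x (S.erase x) * f (S.erase x) else 0 := by
  have h1 : create x f S = inner ℂ (lp.single 2 S (1 : ℂ)) (create x f) := by
    rw [lp.inner_single_left]; simp
  have h2 : annihilate x (lp.single 2 S (1 : ℂ) : FockSpace Γ)
      = if x ∈ S then lp.single 2 (S.erase x) (fockSign x (S.erase x)) else 0 := by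
    ext T
    rw [annihilate_apply, annihilateFun]
    split_ifs with hT hS hS
    · rw [lp.single_apply, Pi.single_apply, if_neg]
      rintro rfl; simp at hT
    · rfl
    · rw [lp.single_apply, lp.single_apply, Pi.single_apply, Pi.single_apply]
      by_cases h : T = S.erase x
      · subst h; simp [Finset.insert_erase hS]
      · rw [if_neg h, if_neg, mul_zero]
        rintro rfl; exact h (by simp [Finset.erase_insert hT])
    · rw [lp.single_apply, Pi.single_apply, if_neg, mul_zero]; rfl
      rintro rfl; simp at hS
  rw [h1, create, ContinuousLinearMap.star_eq_adjoint, ContinuousLinearMap.adjoint_inner_right, h2]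
  split_ifs
  · rw [lp.inner_single_left]
    simp [fockSign, mul_comm]
  · simp

open scoped Classical in
theorem fockSign_insert {Γ : Type*} {x y : Γ} {S : Finset Γ} (hy : y ∉ S) :
    fockSign x (insert y S) = (if WellOrderingRel y x then -1 else 1) * fockSign x S := by
  rw [fockSign, fockSign, Finset.filter_insert]
  split_ifs with h
  · rw [Finset.card_insert_of_notMem (by simp [hy]), pow_succ]; ring
  · simp

open scoped Classical in
theorem fockSign_anti {Γ : Type*} {x y : Γ} {S : Finset Γ} (hxy : x ≠ y) (hx : x ∉ S)
    (hy : y ∉ S) : fockSign x S * fockSign y (insert x S)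
      = - (fockSign y S * fockSign x (insert y S)) := by
  rw [fockSign_insert hy, fockSign_insert hx]
  rcases trichotomous_of WellOrderingRel x y with h | h | h
  · rw [if_pos h, if_neg (asymm h)]; ring
  · exact absurd h hxy
  · rw [if_pos h, if_neg (asymm h)]; ring

theorem fockSign_sq {Γ : Type*} (x : Γ) (S : Finset Γ) : fockSign x S * fockSign x S = 1 := by
  rw [fockSign, ← mul_pow]; simp

open scoped Classical in
/-- Canonical anticommutation relations, first half (the one for `a_x^*, a_y^*` is its adjoint). -/
theorem annihilate_anticomm {Γ : Type*} (x y : Γ) :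
    annihilate x * annihilate y + annihilate y * annihilate x = (0 : FockOp Γ) := by
  ext f S
  change annihilate x (annihilate y f) S + annihilate y (annihilate x f) S = 0
  simp only [annihilate_apply, annihilateFun]
  by_cases hxy : x = y
  · subst hxy; simp
  by_cases hx : x ∈ S
  · simp [hx]
  by_cases hy : y ∈ S
  · simp [hy]
  have := fockSign_anti hxy hx hy
  simp only [hx, hy, Finset.mem_insert, hxy, Ne.symm hxy, if_false, or_self]
  have e : insert y (insert x S) = insert x (insert y S) := Finset.insert_comm _ _ _
  rw [e]
  linear_combination f (insert x (insert y S)) * this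

open scoped Classical in
/-- Canonical anticommutation relations, second half. -/
theorem annihilate_create {Γ : Type*} (x y : Γ) :
    annihilate x * create y + create y * annihilate x = if x = y then (1 : FockOp Γ) else 0 := by
  ext f S
  change annihilate x (create y f) S + create y (annihilate x f) S = _
  simp only [annihilate_apply, annihilateFun, create_apply]
  by_cases hxy : x = y
  · subst hxy
    by_cases hx : x ∈ S
    · simp [hx, ← mul_assoc, fockSign_sq]
    · simp [hx, ← mul_assoc, fockSign_sq]
  · simp only [hxy, if_false]
    by_cases hx : x ∈ S
    · simp [hx, hxy]
    by_cases hy : y ∈ S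
    · obtain ⟨T, hT, rfl⟩ : ∃ T, y ∉ T ∧ S = insert y T := ⟨S.erase y, by simp, by simp [hy]⟩
      have hxT : x ∉ T := fun h => hx (by simp [h])
      have h3 : (insert x (insert y T)).erase y = insert x T := by
        rw [Finset.insert_comm, Finset.erase_insert]; simp [hT, Ne.symm hxy]
      have := fockSign_anti hxy hxT hT
      have h4 := fockSign_sq x T
      have h5 := fockSign_sq x (insert y T)
      simp [h3, hT, hxT, hxy, Ne.symm hxy]
      linear_combination f (insert x T) * (fockSign x T * fockSign x (insert y T) * this
        - fockSign x (insert y T) * fockSign y (insert x T) * h4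
        - fockSign x T * fockSign y T * h5)
    · simp [hx, hy, Ne.symm hxy]

/-- The C*-algebra `𝒜_X` generated by `a_x, a_x^*` with `x ∈ X`, for an arbitrary set `X` of sites;
`𝒜_Γ` is the case `X = Set.univ`. -/
noncomputable def carAlgebra {Γ : Type*} (X : Set Γ) : StarSubalgebra ℂ (FockOp Γ) :=
  (StarAlgebra.adjoin ℂ (annihilate '' X)).topologicalClosure

/-- The local number operator `N_X = ∑_{x ∈ X} a_x^* a_x`. -/
noncomputable def numberOp {Γ : Type*} (X : Finset Γ) : FockOp Γ :=
  ∑ x ∈ X, create x * annihilate x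

/-- The operator `(-1)^{N_X} = exp(iπ N_X)`. -/
noncomputable def paritySign {Γ : Type*} (X : Finset Γ) : FockOp Γ :=
  NormedSpace.exp ((Real.pi * Complex.I : ℂ) • numberOp X)

/-- The set `𝒜_X^+` of even elements of `𝒜_X`: those with `(-1)^{N_X} A (-1)^{N_X} = A`. -/
def evenPart {Γ : Type*} (X : Finset Γ) : Set (FockOp Γ) :=
  {A | A ∈ carAlgebra (X : Set Γ) ∧ paritySign X * A * paritySign X = A}

/-- `Φ` is an even, time-dependent interaction on the time interval `I`
(only the values at times `t ∈ I` matter). -/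
structure IsEvenInteraction {Γ : Type*} (I : Set ℝ) (Φ : Finset Γ → ℝ → FockOp Γ) : Prop where
  selfAdjoint : ∀ X, ∀ t ∈ I, IsSelfAdjoint (Φ X t)
  even : ∀ X, ∀ t ∈ I, Φ X t ∈ evenPart X
  continuousOn : ∀ X, ContinuousOn (Φ X) I

/-- A positive, symmetric decay function `G` with `∑_z G(x,z) G(z,y) ≤ G(x,y)` and
`sup_x ∑_z G(x,z) < ∞`. -/
structure IsDecayFunction {Γ : Type*} (G : Γ → Γ → ℝ) : Prop where
  pos : ∀ x y, 0 < G x y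
  symm : ∀ x y, G x y = G y x
  conv_summable : ∀ x y, Summable fun z => G x z * G z y
  conv_le : ∀ x y, ∑' z, G x z * G z y ≤ G x y
  summable : ∀ x, Summable fun z => G x z
  bounded : ∃ C : ℝ, ∀ x, ∑' z, G x z ≤ C

/-- `φ : I → [0, ∞)` is a locally integrable function with
`∑_{Z ∋ x, y} ‖Φ(Z,t)‖ ≤ φ(t) G(x,y)` for all sites `x, y` and all `t ∈ I`. -/
structure IsInteractionNorm {Γ : Type*} (I : Set ℝ) (G : Γ → Γ → ℝ)
    (Φ : Finset Γ → ℝ → FockOp Γ) (φ : ℝ → ℝ) : Prop where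
  nonneg : ∀ t ∈ I, 0 ≤ φ t
  locallyIntegrableOn : MeasureTheory.LocallyIntegrableOn φ I
  summable : ∀ x y, ∀ t ∈ I, Summable fun Z : {Z : Finset Γ // x ∈ Z ∧ y ∈ Z} => ‖Φ Z t‖
  tsum_le : ∀ x y, ∀ t ∈ I,
    ∑' Z : {Z : Finset Γ // x ∈ Z ∧ y ∈ Z}, ‖Φ Z t‖ ≤ φ t * G x y

/-- The set `ℬ_G^+(I)` of even interactions that decay like `G`. -/
def decayingInteractions {Γ : Type*} (I : Set ℝ) (G : Γ → Γ → ℝ) :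
    Set (Finset Γ → ℝ → FockOp Γ) :=
  {Φ | IsEvenInteraction I Φ ∧ ∃ φ, IsInteractionNorm I G Φ φ}

/-- The finite-volume Hamiltonian `H_Λ(t) = ∑_{X ⊆ Λ} Φ(X,t)`. -/
noncomputable def hamiltonian {Γ : Type*} (Φ : Finset Γ → ℝ → FockOp Γ) (Λ : Finset Γ) (t : ℝ) :
    FockOp Γ :=
  ∑ X ∈ Λ.powerset, Φ X t

/-- `U` is the solution of `d/dt U(t,s) = -i H_Λ(t) U(t,s)`, `U(s,s) = 1`, for `s, t ∈ I`
(with one-sided derivatives at end points of `I` that belong to `I`). -/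
structure IsPropagator {Γ : Type*} (I : Set ℝ) (Φ : Finset Γ → ℝ → FockOp Γ) (Λ : Finset Γ)
    (U : ℝ → ℝ → FockOp Γ) : Prop where
  initial : ∀ s ∈ I, U s s = 1
  hasDeriv : ∀ s ∈ I, ∀ t ∈ I,
    HasDerivWithinAt (fun r => U r s) (-(Complex.I • (hamiltonian Φ Λ t * U t s))) I t

/-- The Heisenberg dynamics `τ_{t,s}(A) = U(t,s)^* A U(t,s)` of a propagator `U`. -/
noncomputable def heisenberg {Γ : Type*} (U : ℝ → ℝ → FockOp Γ) (t s : ℝ) (A : FockOp Γ) :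
    FockOp Γ :=
  star (U t s) * A * U t s

/-- The surface sets `S_Λ(X)`: the finite `Z ⊆ Λ` meeting both `X` and `Λ \ X`. -/
def surfaceSets {Γ : Type*} (Λ X : Set Γ) : Set (Finset Γ) :=
  {Z | (Z : Set Γ) ⊆ Λ ∧ ((Z : Set Γ) ∩ X).Nonempty ∧ ((Z : Set Γ) ∩ (Λ \ X)).Nonempty}

open scoped Classical in
/-- The `Φ`-boundary `∂_Φ X`: the points of `X` that lie in some `Z ∈ S_Γ(X)` with `Φ(Z,t) ≠ 0`
for some `t ∈ I`. -/
noncomputable def interactionBoundary {Γ : Type*} (I : Set ℝ) (Φ : Finset Γ → ℝ → FockOp Γ)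
    (X : Finset Γ) : Finset Γ :=
  X.filter fun x => ∃ Z ∈ surfaceSets Set.univ (X : Set Γ), ∃ t ∈ I, x ∈ Z ∧ Φ Z t ≠ 0

open Set

/-! Split the Hamiltonian as `H_X + H_{Λ∖X} + D`, where `D` collects the interaction sets crossing
the boundary of `X`. Even terms commute with everything in a disjoint region, whether or not `A` and
`B` are even. Hence the decoupled evolution `u₁u₂` of `H_X` and `H_{Λ∖X}` maps `A` to an `A₀` that
still (anti)commutes with `B`. In the interaction picture, with `V = U^* u₁ u₂`, one gets `τ(A) = V
A₀ V^*`, and `V^* B V` has derivative `-i V^* [τ(D), B] V`. So both the commutator and the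
anticommutator of `τ_t(A)` with `B` have norm at most `2‖A‖ ∫ ‖[τ_r(D), B]‖ dr`. Only ordinary
commutators of even terms occur on the right, which is why one argument gives (i) and (ii): `σ = -1`
and `σ = 1` in `IsEvolution.norm_twisted_commutator_le`.

The terms of `D` are even observables again, so the estimate can be iterated. Instead of summing a
series over chains of sets, an inductive bound is propagated: the profile `(e^p - 1) ∑_{y∈Y}
G(z,y)`, with `p = 2∫φ`, plus an error `c p^n/n!` that starts from the trivial commutator bound. The
condition `G * G ≤ G` closes the induction, since the `p`-derivative of the profile of order `n + 1`
dominates `G` convolved with the indicator of `Y` plus the profile of order `n`. The limit `n → ∞`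
removes the error and its volume-dependent constant. The boundary `∂_Φ X` appears because each
nonzero term of `D` contains one of its points. -/

/-! ### Linear evolution equations in a C*-algebra. -/

/-- `u` solves `u' = -i h u`, `u(s) = 1`, on `[s, t]`. -/
structure IsEvolution {𝔄 : Type*} [CStarAlgebra 𝔄] (h u : ℝ → 𝔄) (s t : ℝ) : Prop where
  initial : u s = 1
  hasDeriv : ∀ r ∈ Icc s t,
    HasDerivWithinAt u (-(Complex.I • (h r * u r))) (Icc s t) r

/-- Grönwall uniqueness. It serves to prove identities along a flow: the defect of the identity
vanishes initially and solves a homogeneous linear equation. -/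
theorem eq_zero_of_hasDerivWithinAt_Icc {E : Type*} [NormedAddCommGroup E] [NormedSpace ℝ E]
    {f f' : ℝ → E} {K a b : ℝ} (hf : ∀ r ∈ Icc a b, HasDerivWithinAt f (f' r) (Icc a b) r)
    (ha : f a = 0) (bound : ∀ r ∈ Icc a b, ‖f' r‖ ≤ K * ‖f r‖) : ∀ r ∈ Icc a b, f r = 0 :=
  eq_zero_of_abs_deriv_le_mul_abs_self_of_eq_zero_right
    (fun r hr => (hf r hr).continuousWithinAt)
    (fun r hr => (hf r (Ico_subset_Icc_self hr)).mono_of_mem_nhdsWithin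
      (Icc_mem_nhdsGE_of_mem hr)) ha
    (fun r hr => bound r (Ico_subset_Icc_self hr))

/-- The retraction of a normed space onto its unit ball along rays. -/
noncomputable def unitBallRetract {E : Type*} [NormedAddCommGroup E] [NormedSpace ℝ E] (x : E) : E :=
  (max 1 ‖x‖)⁻¹ • x

section UnitBallRetract

variable {E : Type*} [NormedAddCommGroup E] [NormedSpace ℝ E]

theorem norm_unitBallRetract_le (x : E) : ‖unitBallRetract x‖ ≤ 1 := by
  have h : 0 < max 1 ‖x‖ := lt_max_of_lt_left one_pos
  rw [unitBallRetract, norm_smul, norm_inv, Real.norm_of_nonneg h.le, inv_mul_le_iff₀ h, mul_one]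
  exact le_max_right _ _

theorem unitBallRetract_eq_self {x : E} (hx : ‖x‖ ≤ 1) : unitBallRetract x = x := by
  simp [unitBallRetract, max_eq_left hx]

theorem lipschitzWith_unitBallRetract : LipschitzWith 2 (unitBallRetract : E → E) := by
  refine LipschitzWith.of_dist_le_mul fun x y => ?_
  have ha : 1 ≤ max 1 ‖x‖ := le_max_left _ _
  have hb : 1 ≤ max 1 ‖y‖ := le_max_left _ _
  have hab : |max 1 ‖y‖ - max 1 ‖x‖| ≤ ‖x - y‖ := by
    rw [max_comm 1 ‖y‖, max_comm 1 ‖x‖, abs_sub_comm]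
    exact (abs_max_sub_max_le_abs _ _ _).trans (abs_norm_sub_norm_le x y)
  have hy := le_max_right 1 ‖y‖
  rw [dist_eq_norm, dist_eq_norm]
  unfold unitBallRetract
  generalize max 1 ‖x‖ = a at *
  generalize max 1 ‖y‖ = b at *
  have ha0 : 0 < a := by linarith
  have hb0 : 0 < b := by linarith
  have e : a⁻¹ • x - b⁻¹ • y = a⁻¹ • ((x - y) + ((b - a) / b) • y) := by
    rw [smul_add, smul_sub, smul_smul, sub_add, ← sub_smul]
    congr 2
    field_simp
    ring
  rw [e, norm_smul, norm_inv, Real.norm_of_nonneg ha0.le, inv_mul_le_iff₀ ha0]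
  have h1 : ‖((b - a) / b) • y‖ ≤ ‖x - y‖ := by
    rw [norm_smul, norm_div, Real.norm_eq_abs, Real.norm_of_nonneg hb0.le, div_mul_eq_mul_div,
      div_le_iff₀ hb0]
    gcongr
  have h2 := norm_nonneg (x - y)
  refine (norm_add_le _ _).trans ?_
  push_cast
  nlinarith

end UnitBallRetract

namespace IsEvolution

variable {𝔄 : Type*} [CStarAlgebra 𝔄] {h u : ℝ → 𝔄} {s t : ℝ}

/-- The two contributions to the derivative of `u^* u` cancel exactly because `h` is self-adjoint
and `c` is real. The factor `c` covers the truncated equation used to construct solutions. -/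
theorem star_mul_self_of_smul {c : ℝ → ℝ} (hh : ∀ r ∈ Icc s t, IsSelfAdjoint (h r))
    (h0 : u s = 1) (hu : ∀ r ∈ Icc s t,
      HasDerivWithinAt u (-(Complex.I • (h r * c r • u r))) (Icc s t) r) :
    ∀ r ∈ Icc s t, star (u r) * u r = 1 := by
  intro r hr
  rw [← sub_eq_zero]
  refine eq_zero_of_hasDerivWithinAt_Icc (f := fun r => star (u r) * u r - 1) (K := 0)
    (fun r hr => ((hu r hr).star.mul (hu r hr)).sub_const 1) (by simp [h0]) ?_ r hr
  intro r hr
  simp [(hh r hr).star_eq, mul_assoc]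

theorem star_mul_self (hu : IsEvolution h u s t) (hh : ∀ r ∈ Icc s t, IsSelfAdjoint (h r)) :
    ∀ r ∈ Icc s t, star (u r) * u r = 1 :=
  star_mul_self_of_smul (c := 1) hh hu.initial fun r hr => by simpa using hu.hasDeriv r hr

theorem exists_norm_le (hc : ContinuousOn h (Icc s t)) : ∃ M, 0 ≤ M ∧ ∀ r ∈ Icc s t, ‖h r‖ ≤ M := by
  obtain ⟨M, hM⟩ := isCompact_Icc.exists_bound_of_continuousOn hc
  exact ⟨max M 0, le_max_right _ _, fun r hr => (hM r hr).trans (le_max_left _ _)⟩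

/-- An isometry need not be unitary in infinite dimensions, so this needs its own argument: `w = u
u^* - 1` solves `w' = -i[h, w]` with `w(s) = 0`. -/
theorem mul_star_self (hu : IsEvolution h u s t) (hh : ∀ r ∈ Icc s t, IsSelfAdjoint (h r))
    (hc : ContinuousOn h (Icc s t)) : ∀ r ∈ Icc s t, u r * star (u r) = 1 := by
  intro r hr
  obtain ⟨M, hM0, hM⟩ := exists_norm_le hc
  rw [← sub_eq_zero]
  refine eq_zero_of_hasDerivWithinAt_Icc (f := fun r => u r * star (u r) - 1) (K := M + M)
    (fun r hr => ((hu.hasDeriv r hr).mul (hu.hasDeriv r hr).star).sub_const 1)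
    (by simp [hu.initial]) ?_ r hr
  intro r hr
  have e : -(Complex.I • (h r * u r)) * star (u r) + u r * star (-(Complex.I • (h r * u r)))
      = -(Complex.I • (h r * (u r * star (u r) - 1)))
        + Complex.I • ((u r * star (u r) - 1) * h r) := by
    simp [(hh r hr).star_eq, mul_assoc, mul_sub, sub_mul, smul_sub]
    abel
  rw [e]
  refine (norm_add_le _ _).trans ?_
  rw [norm_neg, norm_smul, norm_smul, Complex.norm_I, one_mul, one_mul, add_mul]
  refine add_le_add ((norm_mul_le _ _).trans ?_) ((norm_mul_le _ _).trans ?_)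
  · gcongr; exact hM r hr
  · rw [mul_comm]; gcongr; exact hM r hr

theorem mem_unitary (hu : IsEvolution h u s t) (hh : ∀ r ∈ Icc s t, IsSelfAdjoint (h r))
    (hc : ContinuousOn h (Icc s t)) {r : ℝ} (hr : r ∈ Icc s t) : u r ∈ unitary 𝔄 :=
  Unitary.mem_iff.2 ⟨hu.star_mul_self hh r hr, hu.mul_star_self hh hc r hr⟩

/-- The commutator solves `[u,b]' = -i h [u,b]` with zero initial value. -/
theorem commute (hu : IsEvolution h u s t) (hc : ContinuousOn h (Icc s t)) {b : 𝔄}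
    (hb : ∀ r ∈ Icc s t, Commute (h r) b) {r : ℝ} (hr : r ∈ Icc s t) : Commute (u r) b := by
  obtain ⟨M, hM0, hM⟩ := exists_norm_le hc
  refine sub_eq_zero.1 ?_
  refine eq_zero_of_hasDerivWithinAt_Icc (f := fun r => u r * b - b * u r) (K := M)
    (fun r hr => ((hu.hasDeriv r hr).mul_const b).sub ((hu.hasDeriv r hr).const_mul b))
    (by simp [hu.initial]) ?_ r hr
  intro r hr
  have e : -(Complex.I • (h r * u r)) * b - b * -(Complex.I • (h r * u r))
      = -(Complex.I • (h r * (u r * b - b * u r))) := by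
    have := (hb r hr).eq
    simp only [neg_mul, mul_neg, smul_mul_assoc, mul_smul_comm, mul_sub, smul_sub, ← mul_assoc, this]
    abel
  rw [e, norm_neg, norm_smul, Complex.norm_I, one_mul]
  refine (norm_mul_le _ _).trans ?_
  gcongr
  exact hM r hr

theorem norm_le_one_of_star_mul_self {x : 𝔄} (hx : star x * x = 1) : ‖x‖ ≤ 1 := by
  cases subsingleton_or_nontrivial 𝔄
  · simp [Subsingleton.elim x 0]
  · have := CStarRing.norm_star_mul_self (x := x)
    rw [hx, CStarRing.norm_one] at this
    nlinarith [norm_nonneg x]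

/-- Picard–Lindelöf on all of `[s, t]` at once needs a bounded vector field, so `u` is first
replaced by its retraction to the unit ball. This multiplies `u` by a positive real scalar, so the
solution is still isometric, stays in the ball, and solves the original equation. -/
theorem exists_of_continuousOn (hst : s ≤ t) (hh : ∀ r ∈ Icc s t, IsSelfAdjoint (h r))
    (hc : ContinuousOn h (Icc s t)) : ∃ u, IsEvolution h u s t := by
  obtain ⟨M, hM0, hM⟩ := exists_norm_le hc
  lift M to NNReal using hM0
  -- The field is bounded by `M`, so the ball of radius `M (t - s)` about `1` cannot be left in time
  -- `t - s`; the Lipschitz constant is `2M` because the retraction is 2-Lipschitz.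
  have hPL : IsPicardLindelof (fun r (x : 𝔄) => -(Complex.I • (h r * unitBallRetract x)))
      (⟨s, left_mem_Icc.2 hst⟩ : Icc s t) (1 : 𝔄) (M * (t - s).toNNReal) 0 M (M * 2) := by
    refine ⟨fun r hr => ?_, fun x _ => ?_, fun r hr x _ => ?_, ?_⟩
    · refine (LipschitzWith.of_dist_le_mul fun x y => ?_).lipschitzOnWith
      rw [dist_neg_neg, dist_smul₀, Complex.norm_I, one_mul, dist_eq_norm, ← mul_sub]
      refine (norm_mul_le _ _).trans ?_
      rw [← dist_eq_norm, NNReal.coe_mul, mul_assoc]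
      gcongr
      · exact hM r hr
      · exact lipschitzWith_unitBallRetract.dist_le_mul x y
    · exact ((hc.mul continuousOn_const).const_smul _).neg
    · rw [norm_neg, norm_smul, Complex.norm_I, one_mul]
      refine (norm_mul_le _ _).trans ?_
      calc _ ≤ (M : ℝ) * 1 := by
            gcongr
            · exact hM r hr
            · exact norm_unitBallRetract_le x
        _ = M := mul_one _
    · simp [hst]
  obtain ⟨u, hu0, hu⟩ := hPL.exists_eq_forall_mem_Icc_hasDerivWithinAt₀
  have key := star_mul_self_of_smul (c := fun r => (max 1 ‖u r‖)⁻¹) hh hu0 hu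
  refine ⟨u, hu0, fun r hr => ?_⟩
  have := hu r hr
  simp only [unitBallRetract_eq_self (norm_le_one_of_star_mul_self (key r hr))] at this
  exact this

end IsEvolution

/-! ### The interaction picture relative to a decoupled evolution. -/

namespace IsEvolution

variable {𝔄 : Type*} [CStarAlgebra 𝔄]

/-- Moving `h₂` to the left past `u₁` makes `h₁ + h₂` cancel against the same terms from `U^*`,
leaving only the coupling `d` in the Heisenberg picture. -/
theorem hasDerivWithinAt_relative {h h₁ h₂ d U u₁ u₂ : ℝ → 𝔄} {s t : ℝ}
    (hU : IsEvolution h U s t) (hu₁ : IsEvolution h₁ u₁ s t) (hu₂ : IsEvolution h₂ u₂ s t)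
    (hsplit : ∀ r, h r = h₁ r + h₂ r + d r) (hsa : ∀ r ∈ Icc s t, IsSelfAdjoint (h r))
    (hUU : ∀ r ∈ Icc s t, U r * star (U r) = 1)
    (hcomm : ∀ r ∈ Icc s t, Commute (u₁ r) (h₂ r)) {r : ℝ} (hr : r ∈ Icc s t) :
    HasDerivWithinAt (fun r => star (U r) * u₁ r * u₂ r)
      (Complex.I • ((star (U r) * d r * U r) * (star (U r) * u₁ r * u₂ r))) (Icc s t) r := by
  have key := ((hU.hasDeriv r hr).star.mul (hu₁.hasDeriv r hr)).mul (hu₂.hasDeriv r hr)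
  refine key.congr_deriv ?_
  have e1 : star (U r) * d r * U r * (star (U r) * u₁ r * u₂ r)
      = star (U r) * d r * (U r * star (U r)) * u₁ r * u₂ r := by simp only [mul_assoc]
  have e2 : u₁ r * (h₂ r * u₂ r) = h₂ r * u₁ r * u₂ r := by
    rw [← mul_assoc, (hcomm r hr).eq]
  rw [e1, hUU r hr, star_neg, star_smul, star_mul, (hsa r hr).star_eq, hsplit r]
  simp only [Pi.mul_apply, Complex.star_def, Complex.conj_I, neg_smul, smul_mul_assoc, mul_smul_comm,
    mul_neg, neg_mul, add_mul, mul_add, mul_one, smul_add, mul_assoc] at e2 ⊢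
  rw [e2]
  abel

theorem hasDerivWithinAt_conj {V p : ℝ → 𝔄} {s t : ℝ} (b : 𝔄)
    (hV : ∀ r ∈ Icc s t, HasDerivWithinAt V (Complex.I • (p r * V r)) (Icc s t) r)
    (hp : ∀ r ∈ Icc s t, IsSelfAdjoint (p r)) {r : ℝ} (hr : r ∈ Icc s t) :
    HasDerivWithinAt (fun r => star (V r) * b * V r)
      (-(Complex.I • (star (V r) * (p r * b - b * p r) * V r))) (Icc s t) r := by
  refine (((hV r hr).star.mul_const b).mul (hV r hr)).congr_deriv ?_
  simp only [star_smul, star_mul, (hp r hr).star_eq, Complex.star_def, Complex.conj_I, neg_smul,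
    smul_mul_assoc, mul_smul_comm, neg_mul, mul_sub, sub_mul, smul_sub, mul_assoc]
  abel

/-- The twisted commutator with `σ` is unitarily conjugate to one between a fixed element `a₀` and a
moving `k`, starting from zero. The velocity of `k` is an untwisted commutator of `d` with `b`, so
`σ` enters only through `‖σ‖ ≤ 1`. The function `β` is a primitive of the assumed bound on that
velocity. -/
theorem norm_twisted_commutator_le {h h₁ h₂ d U : ℝ → 𝔄} {s t : ℝ} (hst : s ≤ t)
    (hU : IsEvolution h U s t) (hsplit : ∀ r, h r = h₁ r + h₂ r + d r)
    (hsa₁ : ∀ r ∈ Icc s t, IsSelfAdjoint (h₁ r)) (hsa₂ : ∀ r ∈ Icc s t, IsSelfAdjoint (h₂ r))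
    (hsad : ∀ r ∈ Icc s t, IsSelfAdjoint (d r)) (hc₁ : ContinuousOn h₁ (Icc s t))
    (hc₂ : ContinuousOn h₂ (Icc s t)) (hcd : ContinuousOn d (Icc s t))
    (h₁₂ : ∀ r ∈ Icc s t, ∀ r' ∈ Icc s t, Commute (h₁ r) (h₂ r')) {a b : 𝔄}
    (h₁b : ∀ r ∈ Icc s t, Commute (h₁ r) b) (h₂a : ∀ r ∈ Icc s t, Commute (h₂ r) a)
    {σ : ℂ} (hσ : ‖σ‖ ≤ 1) (hab : a * b + σ • (b * a) = 0) {β β' : ℝ → ℝ}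
    (hβs : 0 ≤ β s) (hβ : ∀ r, HasDerivAt β (β' r) r)
    (hbound : ∀ r ∈ Icc s t,
      ‖star (U r) * d r * U r * b - b * (star (U r) * d r * U r)‖ ≤ β' r) :
    ‖star (U t) * a * U t * b + σ • (b * (star (U t) * a * U t))‖ ≤ 2 * ‖a‖ * β t := by
  have hsa : ∀ r ∈ Icc s t, IsSelfAdjoint (h r) := fun r hr => by
    rw [hsplit]; exact ((hsa₁ r hr).add (hsa₂ r hr)).add (hsad r hr)
  have hc : ContinuousOn h (Icc s t) :=
    ((hc₁.add hc₂).add hcd).congr fun r _ => hsplit r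
  obtain ⟨u₁, hu₁⟩ := exists_of_continuousOn hst hsa₁ hc₁
  obtain ⟨u₂, hu₂⟩ := exists_of_continuousOn hst hsa₂ hc₂
  have ht : t ∈ Icc s t := right_mem_Icc.2 hst
  have hU' := fun r hr => hU.mem_unitary hsa hc (r := r) hr
  have hu₁' := fun r hr => hu₁.mem_unitary hsa₁ hc₁ (r := r) hr
  have hu₂' := fun r hr => hu₂.mem_unitary hsa₂ hc₂ (r := r) hr
  have hu₁h₂ : ∀ r ∈ Icc s t, ∀ r' ∈ Icc s t, Commute (u₁ r) (h₂ r') := fun r hr r' hr' =>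
    hu₁.commute hc₁ (fun q hq => h₁₂ q hq r' hr') hr
  set V : ℝ → 𝔄 := fun r => star (U r) * u₁ r * u₂ r with hVdef
  have hV' : ∀ r ∈ Icc s t, V r ∈ unitary 𝔄 := fun r hr =>
    mul_mem (mul_mem (Unitary.star_mem (hU' r hr)) (hu₁' r hr)) (hu₂' r hr)
  have hVderiv := fun r hr => hasDerivWithinAt_relative hU hu₁ hu₂ hsplit hsa
    (fun r hr => (Unitary.mem_iff.1 (hU' r hr)).2) (fun r hr => hu₁h₂ r hr r hr) (r := r) hr
  have hk := fun r hr => hasDerivWithinAt_conj (V := V) b hVderiv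
    (fun r hr => (hsad r hr).conjugate' (U r)) (r := r) hr
  -- Evolved to the final time `t` and then kept fixed, so that only `k` depends on `r` in the
  -- derivative below.
  set a₀ := star (u₁ t) * a * u₁ t with ha₀
  have hsu := (Unitary.mem_iff.1 (hu₁' t ht)).1
  have hus := (Unitary.mem_iff.1 (hu₁' t ht)).2
  have hub : u₁ t * b = b * u₁ t := (hu₁.commute hc₁ h₁b ht).eq
  have hsub : star (u₁ t) * b = b * star (u₁ t) := by
    calc star (u₁ t) * b = star (u₁ t) * (b * u₁ t) * star (u₁ t) := by
          rw [mul_assoc, mul_assoc, hus, mul_one]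
      _ = b * star (u₁ t) := by rw [← hub, ← mul_assoc, hsu, one_mul]
  have ha₀b : a₀ * b + σ • (b * a₀) = 0 := by
    have e : a₀ * b + σ • (b * a₀) = star (u₁ t) * (a * b + σ • (b * a)) * u₁ t := by
      have e1 : a₀ * b = star (u₁ t) * (a * b) * u₁ t := by
        rw [ha₀, mul_assoc, hub]; simp only [mul_assoc]
      have e2 : b * a₀ = star (u₁ t) * (b * a) * u₁ t := by
        rw [ha₀, ← mul_assoc, ← mul_assoc, ← hsub]; simp only [mul_assoc]
      rw [e1, e2, mul_add, add_mul, mul_smul_comm, smul_mul_assoc]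
    rw [e, hab, mul_zero, zero_mul]
  have hu₂u₁ : Commute (u₂ t) (u₁ t) :=
    hu₂.commute hc₂ (fun q hq => (hu₁h₂ t ht q hq).symm) ht
  have hu₂a : Commute (u₂ t) a := hu₂.commute hc₂ h₂a ht
  -- The factor `u₂` drops out because it commutes with both `u₁` and `a`; `u₁` undoes the evolution
  -- in `a₀`.
  have hVa : V t * a₀ * star (V t) = star (U t) * a * U t := by
    have e : u₁ t * u₂ t * a₀ = a * (u₁ t * u₂ t) := by
      rw [ha₀, ← hu₂u₁.eq]
      calc u₂ t * u₁ t * (star (u₁ t) * a * u₁ t)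
          = u₂ t * (u₁ t * star (u₁ t)) * a * u₁ t := by simp only [mul_assoc]
        _ = a * (u₂ t * u₁ t) := by rw [hus, mul_one, hu₂a.eq, mul_assoc]
    have hw : u₁ t * u₂ t * star (u₁ t * u₂ t) = 1 :=
      (Unitary.mem_iff.1 (mul_mem (hu₁' t ht) (hu₂' t ht))).2
    calc V t * a₀ * star (V t)
        = star (U t) * (u₁ t * u₂ t * a₀) * star (u₁ t * u₂ t) * U t := by
          simp only [hVdef, star_mul, star_star, mul_assoc]
      _ = star (U t) * a * (u₁ t * u₂ t * star (u₁ t * u₂ t)) * U t := by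
          rw [e]; simp only [mul_assoc]
      _ = star (U t) * a * U t := by rw [hw, mul_one]
  have hnorm_a₀ : ‖a₀‖ ≤ ‖a‖ := by
    rw [ha₀, CStarRing.norm_mul_mem_unitary _ (hu₁' t ht),
      CStarRing.norm_mem_unitary_mul _ (Unitary.star_mem (hu₁' t ht))]
  set k : ℝ → 𝔄 := fun r => star (V r) * b * V r with hkdef
  have hks : k s = b := by simp [hkdef, hVdef, hU.initial, hu₁.initial, hu₂.initial]
  have hVV := (Unitary.mem_iff.1 (hV' t ht)).2
  have hfinal : star (U t) * a * U t * b + σ • (b * (star (U t) * a * U t))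
      = V t * (a₀ * k t + σ • (k t * a₀)) * star (V t) := by
    have e1 : V t * (a₀ * k t) * star (V t)
        = V t * a₀ * star (V t) * b * (V t * star (V t)) := by simp only [hkdef, mul_assoc]
    have e2 : V t * (k t * a₀) * star (V t)
        = (V t * star (V t)) * b * (V t * a₀ * star (V t)) := by simp only [hkdef, mul_assoc]
    rw [mul_add, add_mul, mul_smul_comm, smul_mul_assoc, e1, e2, hVa, hVV, mul_one, one_mul]
  rw [hfinal, CStarRing.norm_mul_mem_unitary _ (Unitary.star_mem (hV' t ht)),
    CStarRing.norm_mem_unitary_mul _ (hV' t ht)]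
  have hm : ∀ r ∈ Icc s t, HasDerivWithinAt (fun r => a₀ * k r + σ • (k r * a₀)) _ (Icc s t) r :=
    fun r hr => ((hk r hr).const_mul a₀).add (((hk r hr).mul_const a₀).const_smul σ)
  refine image_norm_le_of_norm_deriv_right_le_deriv_boundary
    (f := fun r => a₀ * k r + σ • (k r * a₀)) (B := fun r => 2 * ‖a‖ * β r)
    (B' := fun r => 2 * ‖a‖ * β' r)
    (fun r hr => (hm r hr).continuousWithinAt)
    (fun r hr => (hm r (Ico_subset_Icc_self hr)).mono_of_mem_nhdsWithin
      (Icc_mem_nhdsGE_of_mem hr)) ?_ (fun r => (hβ r).const_mul _) ?_ ht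
  · simp only [hks, ha₀b, norm_zero]
    positivity
  · intro r hr
    replace hr := Ico_subset_Icc_self hr
    set q := -(Complex.I • (star (V r) * (star (U r) * d r * U r * b
      - b * (star (U r) * d r * U r)) * V r)) with hq
    have hqn : ‖q‖ ≤ β' r := by
      rw [hq, norm_neg, norm_smul, Complex.norm_I, one_mul,
        CStarRing.norm_mul_mem_unitary _ (hV' r hr),
        CStarRing.norm_mem_unitary_mul _ (Unitary.star_mem (hV' r hr))]
      exact hbound r hr
    calc ‖a₀ * q + σ • (q * a₀)‖ ≤ ‖a₀ * q‖ + ‖σ • (q * a₀)‖ := norm_add_le _ _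
      _ ≤ ‖a₀‖ * ‖q‖ + 1 * (‖q‖ * ‖a₀‖) := by
        rw [norm_smul]
        gcongr <;> exact norm_mul_le _ _
      _ = 2 * (‖a₀‖ * ‖q‖) := by ring
      _ ≤ 2 * (‖a‖ * β' r) := by gcongr
      _ = 2 * ‖a‖ * β' r := by ring

end IsEvolution

/-! ### Fermion parity and commutation of even observables. -/

theorem NormedSpace.exp_smul_of_isIdempotentElem {𝔸 : Type*} [NormedRing 𝔸] [NormedAlgebra ℂ 𝔸]
    [CompleteSpace 𝔸] {n : 𝔸} (hn : IsIdempotentElem n) (c : ℂ) :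
    NormedSpace.exp (c • n) = 1 + (Complex.exp c - 1) • n := by
  have h1 := NormedSpace.exp_series_hasSum_exp' (𝕂 := ℂ) (c • n)
  -- All positive powers of `n` equal `n`; the zeroth power is `1`, whence the correction `1 - n` at
  -- `k = 0`.
  have h2 : HasSum (fun k : ℕ => ((k.factorial : ℂ)⁻¹ • c ^ k) • n + if k = 0 then 1 - n else 0)
      (Complex.exp c • n + (1 - n)) := by
    refine HasSum.add ?_ (hasSum_ite_eq 0 _)
    rw [Complex.exp_eq_exp_ℂ]
    exact (NormedSpace.exp_series_hasSum_exp' (𝕂 := ℂ) c).smul_const n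
  have h3 : (fun k : ℕ => ((k.factorial : ℂ)⁻¹ • c ^ k) • n + if k = 0 then 1 - n else 0)
      = fun k : ℕ => (k.factorial : ℂ)⁻¹ • (c • n) ^ k := by
    funext k
    rcases k with _ | k
    · simp
    · simp [smul_pow, hn.pow_succ_eq, smul_smul]
  rw [h3] at h2
  rw [h1.unique h2, sub_smul, one_smul]
  abel

section CAR

variable {Γ : Type*}

theorem star_annihilate (x : Γ) : star (annihilate x) = create x := rfl

theorem star_create (x : Γ) : star (create x) = annihilate x := star_star _

theorem annihilate_mul_annihilate (x y : Γ) :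
    annihilate x * annihilate y = -(annihilate y * annihilate x : FockOp Γ) :=
  eq_neg_of_add_eq_zero_left (annihilate_anticomm x y)

theorem annihilate_mul_create_of_ne {x y : Γ} (h : x ≠ y) :
    annihilate x * create y = -(create y * annihilate x : FockOp Γ) :=
  eq_neg_of_add_eq_zero_left (by simpa [h] using annihilate_create x y)

theorem annihilate_mul_self (x : Γ) : annihilate x * annihilate x = (0 : FockOp Γ) :=
  have : IsAddTorsionFree (FockOp Γ) := .of_module_rat _
  self_eq_neg.1 (annihilate_mul_annihilate x x)

theorem annihilate_mul_create_self (x : Γ) :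
    annihilate x * create x = 1 - (create x * annihilate x : FockOp Γ) :=
  eq_sub_of_add_eq (by simpa using annihilate_create x x)

theorem annihilate_mul_number (x : Γ) :
    annihilate x * (create x * annihilate x) = (annihilate x : FockOp Γ) := by
  rw [← mul_assoc, annihilate_mul_create_self, sub_mul, one_mul, mul_assoc, annihilate_mul_self,
    mul_zero, sub_zero]

theorem isIdempotentElem_number (x : Γ) :
    IsIdempotentElem (create x * annihilate x : FockOp Γ) := by
  rw [IsIdempotentElem, mul_assoc, annihilate_mul_number]

theorem number_commute_annihilate {x y : Γ} (h : x ≠ y) :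
    Commute (create x * annihilate x : FockOp Γ) (annihilate y) := by
  rw [Commute, SemiconjBy, mul_assoc, annihilate_mul_annihilate x y, ← mul_assoc,
    annihilate_mul_create_of_ne h.symm, mul_neg, neg_mul, mul_assoc]

theorem star_number (x : Γ) :
    star (create x * annihilate x : FockOp Γ) = create x * annihilate x := by
  rw [star_mul, star_annihilate, star_create]

theorem number_commute_create {x y : Γ} (h : x ≠ y) :
    Commute (create x * annihilate x : FockOp Γ) (create y) := by
  have := (number_commute_annihilate h).star_star
  rwa [star_number] at this

theorem number_commute_numberOp (x : Γ) {Z : Finset Γ} (hx : x ∉ Z) :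
    Commute (create x * annihilate x : FockOp Γ) (numberOp Z) :=
  Commute.sum_right _ _ _ fun y hy => by
    have hxy : x ≠ y := fun h => hx (h ▸ hy)
    exact (number_commute_create hxy).mul_right (number_commute_annihilate hxy)

/-- The parity `1 - 2 a_x^* a_x` of a single site. -/
noncomputable def siteParity (x : Γ) : FockOp Γ := 1 - (2 : ℂ) • (create x * annihilate x)

theorem siteParity_mul_self (x : Γ) : siteParity x * siteParity x = 1 := by
  have := (isIdempotentElem_number x).eq
  simp only [siteParity, mul_sub, sub_mul, mul_one, one_mul, smul_mul_assoc, mul_smul_comm, this]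
  module

theorem star_siteParity (x : Γ) : star (siteParity x) = siteParity x := by
  rw [siteParity, star_sub, star_one, star_smul, star_number]
  simp

theorem siteParity_commute_annihilate {x y : Γ} (h : x ≠ y) :
    Commute (siteParity x) (annihilate y) :=
  (Commute.one_left _).sub_left ((number_commute_annihilate h).smul_left _)

theorem siteParity_mul_annihilate (x : Γ) :
    siteParity x * annihilate x = -(annihilate x * siteParity x) := by
  rw [siteParity, mul_sub, mul_smul_comm, annihilate_mul_number, sub_mul, smul_mul_assoc, mul_assoc,
    annihilate_mul_self]
  simp only [one_mul, mul_zero, smul_zero, mul_one]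
  module

theorem paritySign_empty : paritySign (∅ : Finset Γ) = 1 := by
  simp [paritySign, numberOp]

theorem paritySign_insert [DecidableEq Γ] {x : Γ} {Z : Finset Γ} (hx : x ∉ Z) :
    paritySign (insert x Z) = siteParity x * paritySign Z := by
  let : NormedAlgebra ℚ (FockOp Γ) := NormedAlgebra.restrictScalars ℚ ℂ _
  rw [paritySign, numberOp, Finset.sum_insert hx, smul_add, NormedSpace.exp_add_of_commute,
    NormedSpace.exp_smul_of_isIdempotentElem (isIdempotentElem_number x), Complex.exp_pi_mul_I]
  · rw [paritySign, numberOp, siteParity]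
    congr 1
    module
  · exact ((number_commute_numberOp x hx).smul_left _).smul_right _

theorem siteParity_commute_paritySign {x : Γ} {Z : Finset Γ} (hx : x ∉ Z) :
    Commute (siteParity x) (paritySign Z) := by
  classical
  induction Z using Finset.induction_on with
  | empty => rw [paritySign_empty]; exact Commute.one_right _
  | insert y Z hy ih =>
    have hxy : y ≠ x := fun h => hx (by simp [h])
    rw [paritySign_insert hy]
    refine Commute.mul_right ?_ (ih fun h => hx (by simp [h]))
    have h := (number_commute_create hxy.symm).mul_right (number_commute_annihilate hxy.symm)
    exact (((Commute.one_left _).sub_left ((Commute.one_right _ ).smul_left _)).sub_right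
      (((Commute.one_left _).sub_left (h.smul_left _)).smul_right _))

theorem paritySign_mul_self (Z : Finset Γ) : paritySign Z * paritySign Z = 1 := by
  classical
  induction Z using Finset.induction_on with
  | empty => rw [paritySign_empty, mul_one]
  | insert x Z hx ih =>
    rw [paritySign_insert hx, mul_assoc, ← mul_assoc (paritySign Z),
      ← (siteParity_commute_paritySign hx).eq, mul_assoc, ih, mul_one, siteParity_mul_self]

theorem star_paritySign (Z : Finset Γ) : star (paritySign Z) = paritySign Z := by
  classical
  induction Z using Finset.induction_on with
  | empty => rw [paritySign_empty, star_one]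
  | insert x Z hx ih =>
    rw [paritySign_insert hx, star_mul, ih, star_siteParity, (siteParity_commute_paritySign hx).eq]

theorem paritySign_commute_annihilate {Z : Finset Γ} {y : Γ} (hy : y ∉ Z) :
    Commute (paritySign Z) (annihilate y) := by
  classical
  induction Z using Finset.induction_on with
  | empty => rw [paritySign_empty]; exact Commute.one_left _
  | insert x Z hx ih =>
    rw [paritySign_insert hx]
    exact (siteParity_commute_annihilate fun h => hy (by simp [h])).mul_left
      (ih fun h => hy (by simp [h]))

theorem paritySign_mul_annihilate {Z : Finset Γ} {x : Γ} (hx : x ∈ Z) :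
    paritySign Z * annihilate x = -(annihilate x * paritySign Z) := by
  classical
  obtain ⟨W, hW, rfl⟩ : ∃ W, x ∉ W ∧ Z = insert x W := ⟨Z.erase x, by simp, by simp [hx]⟩
  rw [paritySign_insert hW, mul_assoc, (paritySign_commute_annihilate hW).eq, ← mul_assoc,
    siteParity_mul_annihilate, neg_mul, mul_assoc]

theorem paritySign_conj_annihilate {Z : Finset Γ} {x : Γ} (hx : x ∈ Z) :
    paritySign Z * annihilate x * paritySign Z = -annihilate x := by
  rw [paritySign_mul_annihilate hx, neg_mul, mul_assoc, paritySign_mul_self, mul_one]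

/-- Induction principle for norm-closed properties of elements of `𝒜_X`. -/
theorem carAlgebra_induction {X : Set Γ} {p : FockOp Γ → Prop} (closed : IsClosed {A | p A})
    (mem : ∀ x ∈ X, p (annihilate x)) (scalar : ∀ c : ℂ, p (algebraMap ℂ _ c))
    (add : ∀ A B, p A → p B → p (A + B)) (mul : ∀ A B, p A → p B → p (A * B))
    (adj : ∀ A, p A → p (star A)) {A : FockOp Γ} (hA : A ∈ carAlgebra X) : p A := by
  have h : (StarAlgebra.adjoin ℂ (annihilate '' X) : Set (FockOp Γ)) ⊆ {A | p A} := by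
    intro B hB
    induction hB using StarAlgebra.adjoin_induction with
    | mem B hB => obtain ⟨x, hx, rfl⟩ := hB; exact mem x hx
    | algebraMap c => exact scalar c
    | add B C _ _ hB hC => exact add B C hB hC
    | mul B C _ _ hB hC => exact mul B C hB hC
    | star B _ hB => exact adj B hB
  exact closure_minimal h closed hA

/-- Moving `a_y` and `a_y^*` past an element of `𝒜_Z`, `y ∉ Z`, conjugates it by `(-1)^{N_Z}`. -/
theorem annihilate_mul_of_mem_carAlgebra {Z : Finset Γ} {y : Γ} (hy : y ∉ Z) {A : FockOp Γ}
    (hA : A ∈ carAlgebra (Z : Set Γ)) :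
    annihilate y * A = paritySign Z * A * paritySign Z * annihilate y ∧
      create y * A = paritySign Z * A * paritySign Z * create y := by
  have hPP := paritySign_mul_self Z
  have hPs := star_paritySign Z
  have hPa : ∀ x ∈ Z, paritySign Z * annihilate x * paritySign Z = -annihilate x :=
    fun x hx => paritySign_conj_annihilate hx
  have hca := paritySign_commute_annihilate hy
  have hcc : Commute (paritySign Z) (create y) := by
    have := hca.star_star
    rwa [hPs] at this
  generalize paritySign Z = P at *
  -- Adjoints exchange `a_y` and `a_y^*`, so the two relations are carried through the induction
  -- together.
  have aux : ∀ {b A : FockOp Γ}, Commute P b → star b * A = P * A * P * star b →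
      b * star A = P * star A * P * b := by
    intro b A hb h
    have h1 := congrArg star h
    simp only [star_mul, star_star, hPs] at h1
    have h2 : star A * b = b * (P * star A * P) := by simpa [mul_assoc] using h1
    calc b * star A = b * (P * P) * star A * (P * P) := by simp [hPP]
      _ = P * (b * (P * star A * P)) * P := by
        simp only [mul_assoc]; rw [← mul_assoc b P, ← hb.eq, mul_assoc]
      _ = P * star A * P * b := by rw [← h2, mul_assoc, mul_assoc, ← hb.eq]; simp only [mul_assoc]
  refine carAlgebra_induction ?_ ?_ ?_ ?_ ?_ ?_ hA
    (p := fun A => annihilate y * A = P * A * P * annihilate y ∧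
      create y * A = P * A * P * create y)
  · refine (isClosed_eq ?_ ?_).inter (isClosed_eq ?_ ?_) <;> fun_prop
  · intro x hx
    have hyx : y ≠ x := fun h => hy (h ▸ hx)
    rw [hPa x hx, neg_mul, neg_mul, annihilate_mul_annihilate, annihilate_mul_create_of_ne hyx.symm,
      neg_neg]
    exact ⟨rfl, rfl⟩
  · intro c
    have h1 := fun b => (Algebra.commutes c (b : FockOp Γ)).symm
    constructor <;> rw [h1, h1, mul_assoc _ P P, hPP, mul_one]
  · rintro A B ⟨hA, hA'⟩ ⟨hB, hB'⟩
    constructor <;> simp only [mul_add, add_mul, hA, hA', hB, hB']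
  · rintro A B ⟨hA, hA'⟩ ⟨hB, hB'⟩
    have e : P * (A * B) * P = P * A * P * (P * B * P) := by
      calc P * (A * B) * P = P * A * (P * P) * B * P := by rw [hPP]; simp only [mul_one, mul_assoc]
        _ = _ := by simp only [mul_assoc]
    constructor
    · rw [e, mul_assoc _ _ (annihilate y), ← hB, ← mul_assoc, hA, mul_assoc]
    · rw [e, mul_assoc _ _ (create y), ← hB', ← mul_assoc, hA', mul_assoc]
  · rintro A ⟨hA, hA'⟩
    exact ⟨aux hca (by rwa [star_annihilate]), aux hcc (by rwa [star_create])⟩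

/-- Even observables commute with all observables of a disjoint region. -/
theorem commute_of_mem_evenPart {Z : Finset Γ} {Y : Set Γ} (hZY : Disjoint (Z : Set Γ) Y)
    {A B : FockOp Γ} (hA : A ∈ evenPart Z) (hB : B ∈ carAlgebra Y) : Commute A B := by
  -- Commutation with `A` alone is not visibly stable under adjoints, so `B` and `star B` are
  -- treated jointly.
  refine (carAlgebra_induction (p := fun B => Commute A B ∧ Commute A (star B)) ?_ ?_ ?_ ?_ ?_ ?_
    hB).1
  · refine (isClosed_eq ?_ ?_).inter (isClosed_eq ?_ ?_) <;> fun_prop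
  · intro y hy
    have := annihilate_mul_of_mem_carAlgebra (fun h => disjoint_left.1 hZY h hy) hA.1
    rw [hA.2] at this
    exact ⟨this.1.symm, this.2.symm⟩
  · intro c
    rw [← algebraMap_star_comm]
    exact ⟨(Algebra.commutes _ A).symm, (Algebra.commutes _ A).symm⟩
  · rintro B C ⟨hB, hB'⟩ ⟨hC, hC'⟩
    rw [star_add]
    exact ⟨hB.add_right hC, hB'.add_right hC'⟩
  · rintro B C ⟨hB, hB'⟩ ⟨hC, hC'⟩
    rw [star_mul]
    exact ⟨hB.mul_right hC, hC'.mul_right hB'⟩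
  · rintro B ⟨hB, hB'⟩
    rw [star_star]
    exact ⟨hB', hB⟩

end CAR

/-! ### Sums over interaction sets and convolution with the decay function. -/

section Combinatorics

variable {Γ : Type*}

-- Each contributing `W` is charged to all points of `D` it contains, of which there is at least
-- one. After exchanging sums, the total weight of sets through a pair `x, z` is controlled by `φ *
-- G x z`.
open scoped Classical in
theorem sum_mul_sum_le_of_meets {Λ D : Finset Γ} {F : Finset (Finset Γ)} {w : Finset Γ → ℝ}
    {G : Γ → Γ → ℝ} {f : Γ → ℝ} {φ : ℝ} (hD : D ⊆ Λ) (hF : F ⊆ Λ.powerset) (hw : ∀ W, 0 ≤ w W)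
    (hf : ∀ z, 0 ≤ f z) (hmeet : ∀ W ∈ F, w W ≠ 0 → ∃ x ∈ D, x ∈ W)
    (hpair : ∀ x ∈ Λ, ∀ z ∈ Λ, ∑ W ∈ Λ.powerset with x ∈ W ∧ z ∈ W, w W ≤ φ * G x z) :
    ∑ W ∈ F, w W * ∑ z ∈ W, f z ≤ φ * ∑ x ∈ D, ∑ z ∈ Λ, G x z * f z := by
  have h1 : ∀ W ∈ F, w W * ∑ z ∈ W, f z
      ≤ ∑ x ∈ D, ∑ z ∈ Λ, if x ∈ W ∧ z ∈ W then w W * f z else 0 := by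
    intro W hW
    have hWΛ := Finset.mem_powerset.1 (hF hW)
    have e : ∀ x, x ∈ W → ∑ z ∈ Λ, (if x ∈ W ∧ z ∈ W then w W * f z else 0)
        = w W * ∑ z ∈ W, f z := by
      intro x hx
      simp only [hx, true_and]
      rw [← Finset.sum_filter, Finset.filter_mem_eq_inter, Finset.inter_eq_right.2 hWΛ,
        Finset.mul_sum]
    have hnn : ∀ x ∈ D, 0 ≤ ∑ z ∈ Λ, if x ∈ W ∧ z ∈ W then w W * f z else 0 := fun x _ =>
      Finset.sum_nonneg fun z _ => by split_ifs; exacts [mul_nonneg (hw W) (hf z), le_rfl]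
    by_cases h0 : w W = 0
    · rw [h0, zero_mul]
      simp
    · obtain ⟨x, hx, hxW⟩ := hmeet W hW h0
      rw [← e x hxW]
      exact Finset.single_le_sum hnn hx
  calc ∑ W ∈ F, w W * ∑ z ∈ W, f z
      ≤ ∑ W ∈ F, ∑ x ∈ D, ∑ z ∈ Λ, (if x ∈ W ∧ z ∈ W then w W * f z else 0) :=
        Finset.sum_le_sum h1
    _ ≤ ∑ W ∈ Λ.powerset, ∑ x ∈ D, ∑ z ∈ Λ, (if x ∈ W ∧ z ∈ W then w W * f z else 0) :=
        Finset.sum_le_sum_of_subset_of_nonneg hF fun W _ _ =>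
          Finset.sum_nonneg fun x _ => Finset.sum_nonneg fun z _ => by
            split_ifs; exacts [mul_nonneg (hw W) (hf z), le_rfl]
    _ = ∑ x ∈ D, ∑ z ∈ Λ, (∑ W ∈ Λ.powerset with x ∈ W ∧ z ∈ W, w W) * f z := by
        rw [Finset.sum_comm]
        refine Finset.sum_congr rfl fun x _ => ?_
        rw [Finset.sum_comm]
        refine Finset.sum_congr rfl fun z _ => ?_
        rw [Finset.sum_mul, Finset.sum_filter]
    _ ≤ ∑ x ∈ D, ∑ z ∈ Λ, (φ * G x z) * f z :=
        Finset.sum_le_sum fun x hx => Finset.sum_le_sum fun z hz =>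
          mul_le_mul_of_nonneg_right (hpair x (hD hx) z hz) (hf z)
    _ = φ * ∑ x ∈ D, ∑ z ∈ Λ, G x z * f z := by
        simp only [Finset.mul_sum, mul_assoc]

theorem IsDecayFunction.sum_mul_sum_le {G : Γ → Γ → ℝ} (hG : IsDecayFunction G) (Λ Y : Finset Γ)
    (x : Γ) : ∑ z ∈ Λ, G x z * ∑ y ∈ Y, G z y ≤ ∑ y ∈ Y, G x y := by
  simp only [Finset.mul_sum]
  rw [Finset.sum_comm]
  refine Finset.sum_le_sum fun y _ => ?_
  exact ((hG.conv_summable x y).sum_le_tsum Λ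
    fun z _ => (mul_pos (hG.pos x z) (hG.pos z y)).le).trans (hG.conv_le x y)

end Combinatorics

/-! ### Finite-volume dynamics and the splitting of the Hamiltonian. -/

section Dynamics

variable {Γ : Type*} {I : Set ℝ} {Φ : Finset Γ → ℝ → FockOp Γ} {Λ : Finset Γ}
  {U : ℝ → ℝ → FockOp Γ}

theorem IsEvenInteraction.isSelfAdjoint_sum (hΦ : IsEvenInteraction I Φ) (F : Finset (Finset Γ))
    {r : ℝ} (hr : r ∈ I) : IsSelfAdjoint (∑ W ∈ F, Φ W r) :=
  _root_.isSelfAdjoint_sum _ fun W _ => hΦ.selfAdjoint W r hr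

theorem IsEvenInteraction.continuousOn_sum (hΦ : IsEvenInteraction I Φ) (F : Finset (Finset Γ)) :
    ContinuousOn (fun r => ∑ W ∈ F, Φ W r) I :=
  continuousOn_finsetSum _ fun W _ => hΦ.continuousOn W

theorem IsPropagator.isEvolution (hU : IsPropagator I Φ Λ U) {s t : ℝ} (hs : s ∈ I)
    (hst : Icc s t ⊆ I) : IsEvolution (hamiltonian Φ Λ) (fun r => U r s) s t :=
  ⟨hU.initial s hs, fun r hr => (hU.hasDeriv s hs r (hst hr)).mono hst⟩

theorem IsPropagator.mem_unitary (hU : IsPropagator I Φ Λ U) (hΦ : IsEvenInteraction I Φ)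
    {s t : ℝ} (hs : s ∈ I) (hst : Icc s t ⊆ I) {r : ℝ} (hr : r ∈ Icc s t) :
    U r s ∈ unitary (FockOp Γ) :=
  (hU.isEvolution hs hst).mem_unitary (fun _ hr => hΦ.isSelfAdjoint_sum _ (hst hr))
    ((hΦ.continuousOn_sum _).mono hst) hr

theorem norm_heisenberg (hU : IsPropagator I Φ Λ U) (hΦ : IsEvenInteraction I Φ)
    {s t : ℝ} (hs : s ∈ I) (hst : Icc s t ⊆ I) {r : ℝ} (hr : r ∈ Icc s t) (A : FockOp Γ) :
    ‖heisenberg U r s A‖ = ‖A‖ := by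
  have h := hU.mem_unitary hΦ hs hst hr
  rw [heisenberg, CStarRing.norm_mul_mem_unitary _ h,
    CStarRing.norm_mem_unitary_mul _ (Unitary.star_mem h)]

theorem norm_commutator_heisenberg_le (hU : IsPropagator I Φ Λ U) (hΦ : IsEvenInteraction I Φ)
    {s t : ℝ} (hs : s ∈ I) (hst : Icc s t ⊆ I) {r : ℝ} (hr : r ∈ Icc s t) (A B : FockOp Γ) :
    ‖heisenberg U r s A * B - B * heisenberg U r s A‖ ≤ 2 * ‖A‖ * ‖B‖ := by
  have h := norm_heisenberg hU hΦ hs hst hr A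
  calc _ ≤ ‖heisenberg U r s A * B‖ + ‖B * heisenberg U r s A‖ := norm_sub_le _ _
    _ ≤ ‖heisenberg U r s A‖ * ‖B‖ + ‖B‖ * ‖heisenberg U r s A‖ :=
      add_le_add (norm_mul_le _ _) (norm_mul_le _ _)
    _ = 2 * ‖A‖ * ‖B‖ := by rw [h]; ring

open scoped Classical in
/-- The sets `Z ⊆ Λ` that meet both `X` and its complement. -/
noncomputable def crossingSets (Λ X : Finset Γ) : Finset (Finset Γ) :=
  Λ.powerset.filter fun W => ¬ W ⊆ X ∧ ¬ Disjoint W X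

theorem crossingSets_subset (Λ X : Finset Γ) : crossingSets Λ X ⊆ Λ.powerset := by
  classical
  exact Finset.filter_subset _ _

theorem exists_mem_interactionBoundary {X W : Finset Γ} (hW : W ∈ crossingSets Λ X) {r : ℝ}
    (hr : r ∈ I) (h : Φ W r ≠ 0) : ∃ x ∈ interactionBoundary I Φ X, x ∈ W := by
  classical
  obtain ⟨-, hWX, hd⟩ := Finset.mem_filter.1 hW
  obtain ⟨x, hxW, hxX⟩ := Finset.not_disjoint_iff.1 hd
  obtain ⟨y, hyW, hyX⟩ := Finset.not_subset.1 hWX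
  exact ⟨x, Finset.mem_filter.2 ⟨hxX, W, ⟨subset_univ _, ⟨x, hxW, hxX⟩, ⟨y, hyW, trivial, hyX⟩⟩,
    r, hr, hxW, h⟩, hxW⟩

theorem interactionBoundary_subset (I : Set ℝ) (Φ : Finset Γ → ℝ → FockOp Γ) (X : Finset Γ) :
    interactionBoundary I Φ X ⊆ X := by
  classical
  exact Finset.filter_subset _ _

theorem norm_twisted_heisenberg_le (hΦ : IsEvenInteraction I Φ) (hU : IsPropagator I Φ Λ U)
    {X Y : Finset Γ} (hXY : Disjoint X Y) {A B : FockOp Γ} (hA : A ∈ carAlgebra (X : Set Γ))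
    (hB : B ∈ carAlgebra (Y : Set Γ)) {σ : ℂ} (hσ : ‖σ‖ ≤ 1) (hAB : A * B + σ • (B * A) = 0)
    {s t : ℝ} (hs : s ∈ I) (hI : Icc s t ⊆ I) (hst : s ≤ t) {β β' : ℝ → ℝ} (hβs : 0 ≤ β s)
    (hβ : ∀ r, HasDerivAt β (β' r) r)
    (hbound : ∀ r ∈ Icc s t, ∑ W ∈ crossingSets Λ X,
      ‖heisenberg U r s (Φ W r) * B - B * heisenberg U r s (Φ W r)‖ ≤ β' r) :
    ‖heisenberg U t s A * B + σ • (B * heisenberg U t s A)‖ ≤ 2 * ‖A‖ * β t := by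
  classical
  -- The three classes are the sets inside `X`, the sets disjoint from `X`, and the crossing sets.
  -- The empty set lies in the first.
  set F₁ := Λ.powerset.filter fun W => W ⊆ X with hF₁
  set F₂ := Λ.powerset.filter fun W => ¬ W ⊆ X ∧ Disjoint W X with hF₂
  have hdis : ∀ {Z W : Finset Γ}, Disjoint Z W → Disjoint (Z : Set Γ) (W : Set Γ) :=
    fun h => Finset.disjoint_coe.2 h
  refine IsEvolution.norm_twisted_commutator_le (h := hamiltonian Φ Λ) (U := fun r => U r s)
    (h₁ := fun r => ∑ W ∈ F₁, Φ W r) (h₂ := fun r => ∑ W ∈ F₂, Φ W r)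
    (d := fun r => ∑ W ∈ crossingSets Λ X, Φ W r) hst (hU.isEvolution hs hI) ?_
    (fun r hr => hΦ.isSelfAdjoint_sum _ (hI hr)) (fun r hr => hΦ.isSelfAdjoint_sum _ (hI hr))
    (fun r hr => hΦ.isSelfAdjoint_sum _ (hI hr)) ((hΦ.continuousOn_sum _).mono hI)
    ((hΦ.continuousOn_sum _).mono hI) ((hΦ.continuousOn_sum _).mono hI) ?_ ?_ ?_ hσ hAB hβs hβ ?_
  · intro r
    rw [hamiltonian, ← Finset.sum_filter_add_sum_filter_not Λ.powerset (fun W => W ⊆ X), add_assoc]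
    congr 1
    rw [← Finset.sum_filter_add_sum_filter_not (Λ.powerset.filter fun W => ¬ W ⊆ X)
      (fun W => Disjoint W X), Finset.filter_filter, Finset.filter_filter]
    rfl
  · intro r hr r' hr'
    refine Commute.sum_left _ _ _ fun W hW => Commute.sum_right _ _ _ fun W' hW' => ?_
    have h1 := (Finset.mem_filter.1 hW).2
    have h2 := (Finset.mem_filter.1 hW').2.2
    exact commute_of_mem_evenPart (hdis (h2.mono_right h1).symm) (hΦ.even W r (hI hr))
      (hΦ.even W' r' (hI hr')).1
  · intro r hr
    refine Commute.sum_left _ _ _ fun W hW => ?_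
    exact commute_of_mem_evenPart (hdis (hXY.mono_left (Finset.mem_filter.1 hW).2))
      (hΦ.even W r (hI hr)) hB
  · intro r hr
    refine Commute.sum_left _ _ _ fun W hW => ?_
    exact commute_of_mem_evenPart (hdis (Finset.mem_filter.1 hW).2.2) (hΦ.even W r (hI hr)) hA
  · intro r hr
    refine le_trans ?_ (hbound r hr)
    simp only [Finset.mul_sum, Finset.sum_mul, ← Finset.sum_sub_distrib]
    exact norm_sum_le _ _

end Dynamics

/-! ### Iteration of the estimate and passage to the limit. -/

section LiebRobinson

variable {Γ : Type*} {I : Set ℝ} {Φ : Finset Γ → ℝ → FockOp Γ} {Λ : Finset Γ}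
  {U : ℝ → ℝ → FockOp Γ} {G : Γ → Γ → ℝ}

-- The given `ψ` is only locally integrable, whereas the differential inequalities need a primitive
-- differentiable everywhere. In finite volume the optimal constant, a maximum of finitely many
-- continuous ratios, is continuous and lies below `ψ`.
open scoped Classical in
theorem exists_continuous_interactionNorm_minorant (hG : IsDecayFunction G)
    (hΦ : IsEvenInteraction I Φ) {ψ : ℝ → ℝ} (hψ : IsInteractionNorm I G Φ ψ) (Λ : Finset Γ)
    {s t : ℝ} (hst : s ≤ t) (hI : Icc s t ⊆ I) :
    ∃ φ : ℝ → ℝ, Continuous φ ∧ (∀ r, 0 ≤ φ r) ∧ (∀ r ∈ Icc s t, φ r ≤ ψ r) ∧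
      ∀ r ∈ Icc s t, ∀ x ∈ Λ, ∀ z ∈ Λ,
        ∑ W ∈ Λ.powerset with x ∈ W ∧ z ∈ W, ‖Φ W r‖ ≤ φ r * G x z := by
  -- Values in `NNReal` make the supremum over a possibly empty `Λ ×ˢ Λ` meaningful, equal to `0`.
  set m : ℝ → NNReal := fun r => (Λ ×ˢ Λ).sup fun p =>
    (∑ W ∈ Λ.powerset with p.1 ∈ W ∧ p.2 ∈ W, ‖Φ W r‖₊) / (G p.1 p.2).toNNReal with hm
  have hmc : ContinuousOn m I := by
    refine ContinuousOn.finset_sup_apply fun p _ => ContinuousOn.div_const ?_ _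
    exact continuousOn_finsetSum _ fun W _ => (hΦ.continuousOn W).nnnorm
  refine ⟨fun r => m (projIcc s t hst r), ?_, fun r => NNReal.coe_nonneg _, fun r hr => ?_,
    fun r hr x hx z hz => ?_⟩
  · exact NNReal.continuous_coe.comp ((hmc.mono hI).comp_continuous
      (continuous_subtype_val.comp continuous_projIcc) fun r => (projIcc s t hst r).2)
  · simp only [projIcc_of_mem hst hr]
    have hψr := hψ.nonneg r (hI hr)
    rw [← Real.coe_toNNReal _ hψr, NNReal.coe_le_coe]
    refine Finset.sup_le fun p _ => ?_
    refine div_le_of_le_mul₀ (by positivity) (by positivity) ?_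
    rw [← Real.toNNReal_mul hψr, Real.le_toNNReal_iff_coe_le (mul_nonneg hψr (hG.pos _ _).le)]
    push_cast
    refine le_trans ?_ (hψ.tsum_le p.1 p.2 r (hI hr))
    have hs := hψ.summable p.1 p.2 r (hI hr)
    have e : ∑ W ∈ Λ.powerset with p.1 ∈ W ∧ p.2 ∈ W, ‖Φ W r‖
        = ∑ Z ∈ Λ.powerset.subtype (fun Z => p.1 ∈ Z ∧ p.2 ∈ Z), ‖Φ Z r‖ :=
      (Finset.sum_subtype_eq_sum_filter (fun W => ‖Φ W r‖)).symm
    rw [e]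
    exact hs.sum_le_tsum _ fun _ _ => norm_nonneg _
  · simp only [projIcc_of_mem hst hr]
    have hpos := hG.pos x z
    rw [← div_le_iff₀ hpos]
    have := Finset.le_sup (f := fun p : Γ × Γ =>
      (∑ W ∈ Λ.powerset with p.1 ∈ W ∧ p.2 ∈ W, ‖Φ W r‖₊) / (G p.1 p.2).toNNReal)
      (Finset.mk_mem_product hx hz)
    have h2 := NNReal.coe_le_coe.2 this
    push_cast [Real.coe_toNNReal _ hpos.le] at h2
    exact h2

/-- The `n`-th approximate Lieb–Robinson profile at integrated interaction strength `p`: the limit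
profile `(e^p - 1) ∑_{y ∈ Y} G(z,y)` plus an error of order `p^n / n!`. -/
noncomputable def approxProfile (G : Γ → Γ → ℝ) (Λ Y : Finset Γ) (c : ℝ) (n : ℕ) (p : ℝ) (z : Γ) :
    ℝ :=
  (Real.exp p - 1) * ∑ y ∈ Y, G z y + c * (p ^ n / n.factorial) * ∑ y ∈ Λ, G z y

theorem approxProfile_nonneg (hG : IsDecayFunction G) (Λ Y : Finset Γ) {c : ℝ} (hc : 0 ≤ c) (n : ℕ)
    {p : ℝ} (hp : 0 ≤ p) (z : Γ) : 0 ≤ approxProfile G Λ Y c n p z := by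
  have h1 : 0 ≤ Real.exp p - 1 := by linarith [Real.one_le_exp hp]
  have h2 : ∀ S : Finset Γ, 0 ≤ ∑ y ∈ S, G z y := fun S =>
    Finset.sum_nonneg fun y _ => (hG.pos z y).le
  have := h2 Λ
  have := h2 Y
  rw [approxProfile]
  positivity

theorem hasDerivAt_pow_div_factorial (n : ℕ) (p : ℝ) :
    HasDerivAt (fun p : ℝ => p ^ (n + 1) / (n + 1).factorial) (p ^ n / n.factorial) p := by
  refine ((hasDerivAt_pow (n + 1) p).div_const _).congr_deriv ?_
  have : (n.factorial : ℝ) ≠ 0 := by positivity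
  rw [Nat.factorial_succ]
  push_cast
  field_simp

theorem hasDerivAt_approxProfile (Y : Finset Γ) (c : ℝ) (n : ℕ) (p : ℝ) (z : Γ) :
    HasDerivAt (fun p => approxProfile G Λ Y c (n + 1) p z)
      (∑ y ∈ Y, G z y + approxProfile G Λ Y c n p z) p := by
  refine ((((Real.hasDerivAt_exp p).sub_const 1).mul_const _).add
    (((hasDerivAt_pow_div_factorial n p).const_mul c).mul_const _)).congr_deriv ?_
  rw [approxProfile]
  ring

/-- Both terms of the profile are sums of `G z y` over `y` with nonnegative coefficients, so the
convolution inequality applies to each. -/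
theorem sum_mul_approxProfile_le (hG : IsDecayFunction G) (Y : Finset Γ) {c : ℝ} (hc : 0 ≤ c)
    (n : ℕ) {p : ℝ} (hp : 0 ≤ p) (x : Γ) :
    ∑ z ∈ Λ, G x z * approxProfile G Λ Y c n p z ≤ approxProfile G Λ Y c n p x := by
  have h1 : 0 ≤ Real.exp p - 1 := by linarith [Real.one_le_exp hp]
  calc ∑ z ∈ Λ, G x z * approxProfile G Λ Y c n p z
      = (Real.exp p - 1) * ∑ z ∈ Λ, G x z * ∑ y ∈ Y, G z y
        + c * (p ^ n / n.factorial) * ∑ z ∈ Λ, G x z * ∑ y ∈ Λ, G z y := by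
        rw [Finset.mul_sum, Finset.mul_sum, ← Finset.sum_add_distrib]
        refine Finset.sum_congr rfl fun z _ => ?_
        rw [approxProfile]; ring
    _ ≤ _ := by
        rw [approxProfile]
        exact add_le_add (mul_le_mul_of_nonneg_left (hG.sum_mul_sum_le _ _ _) h1)
          (mul_le_mul_of_nonneg_left (hG.sum_mul_sum_le _ _ _) (by positivity))

open scoped Classical in
/-- One iteration: a bound on commutators of evolved even observables improves from order `n` to
order `n + 1`. -/
theorem norm_twisted_heisenberg_le_approxProfile (hG : IsDecayFunction G)
    (hΦ : IsEvenInteraction I Φ) (hU : IsPropagator I Φ Λ U) {X Y : Finset Γ} (hX : X ⊆ Λ)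
    (hY : Y ⊆ Λ) (hXY : Disjoint X Y) {A B : FockOp Γ} (hA : A ∈ carAlgebra (X : Set Γ))
    (hB : B ∈ carAlgebra (Y : Set Γ)) {σ : ℂ} (hσ : ‖σ‖ ≤ 1) (hAB : A * B + σ • (B * A) = 0)
    {s t : ℝ} (hs : s ∈ I) (hI : Icc s t ⊆ I) (hst : s ≤ t) {φ : ℝ → ℝ} (hφc : Continuous φ)
    (hφ0 : ∀ r, 0 ≤ φ r) (hφ : ∀ r ∈ Icc s t, ∀ x ∈ Λ, ∀ z ∈ Λ,
      ∑ W ∈ Λ.powerset with x ∈ W ∧ z ∈ W, ‖Φ W r‖ ≤ φ r * G x z) {c : ℝ} (hc : 0 ≤ c) {n : ℕ}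
    (hn : ∀ W ⊆ Λ, W.Nonempty → ∀ C ∈ evenPart W, ∀ r ∈ Icc s t,
      ‖heisenberg U r s C * B - B * heisenberg U r s C‖ ≤ 2 * ‖C‖ * ‖B‖ *
        ∑ z ∈ W, ((if z ∈ Y then 1 else 0) +
          approxProfile G Λ Y c n (2 * ∫ q in s..r, φ q) z)) :
    ‖heisenberg U t s A * B + σ • (B * heisenberg U t s A)‖ ≤ 2 * ‖A‖ * ‖B‖ *
      ∑ x ∈ interactionBoundary I Φ X, approxProfile G Λ Y c (n + 1) (2 * ∫ q in s..t, φ q) x := by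
  set D := interactionBoundary I Φ X
  have hD : D ⊆ Λ := (interactionBoundary_subset I Φ X).trans hX
  -- The factor `2` comes from the factor `2 * ‖C‖ * ‖B‖` in the inductive bound, applied to the
  -- crossing terms.
  set p : ℝ → ℝ := fun r => 2 * ∫ q in s..r, φ q with hp
  have hp0 : ∀ r, s ≤ r → 0 ≤ p r := fun r hr =>
    mul_nonneg zero_le_two (intervalIntegral.integral_nonneg hr fun q _ => hφ0 q)
  have hpd : ∀ r, HasDerivAt p (2 * φ r) r := fun r =>
    (hφc.integral_hasStrictDerivAt s r).hasDerivAt.const_mul 2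
  rw [mul_assoc (2 * ‖A‖)]
  refine norm_twisted_heisenberg_le hΦ hU hXY hA hB hσ hAB hs hI hst
    (β := fun r => ‖B‖ * ∑ x ∈ D, approxProfile G Λ Y c (n + 1) (p r) x)
    (β' := fun r => ‖B‖ *
      ∑ x ∈ D, (∑ y ∈ Y, G x y + approxProfile G Λ Y c n (p r) x) * (2 * φ r)) ?_ ?_ ?_
  · exact mul_nonneg (norm_nonneg _) (Finset.sum_nonneg fun x _ =>
      approxProfile_nonneg hG _ _ hc _ (hp0 s le_rfl) x)
  · intro r
    refine HasDerivAt.const_mul _ (HasDerivAt.fun_sum fun x _ => ?_)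
    exact (hasDerivAt_approxProfile Y c n (p r) x).comp r (hpd r)
  · intro r hr
    have hpr := hp0 r hr.1
    set f : Γ → ℝ := fun z => (if z ∈ Y then 1 else 0) + approxProfile G Λ Y c n (p r) z with hf
    have hf0 : ∀ z, 0 ≤ f z := fun z =>
      add_nonneg (by split_ifs <;> norm_num) (approxProfile_nonneg hG _ _ hc _ hpr z)
    -- Convolving the indicator of `Y` produces `∑ y ∈ Y, G x y`, so the right side is the
    -- `p`-derivative of the next profile.
    have hconv : ∀ x, ∑ z ∈ Λ, G x z * f z
        ≤ ∑ y ∈ Y, G x y + approxProfile G Λ Y c n (p r) x := by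
      intro x
      simp only [hf, mul_add, Finset.sum_add_distrib]
      refine add_le_add (le_of_eq ?_) (sum_mul_approxProfile_le hG Y hc n hpr x)
      simp only [mul_ite, mul_one, mul_zero]
      rw [← Finset.sum_filter, Finset.filter_mem_eq_inter, Finset.inter_eq_right.2 hY]
    calc ∑ W ∈ crossingSets Λ X,
          ‖heisenberg U r s (Φ W r) * B - B * heisenberg U r s (Φ W r)‖
        ≤ ∑ W ∈ crossingSets Λ X, 2 * ‖Φ W r‖ * ‖B‖ * ∑ z ∈ W, f z := by
          refine Finset.sum_le_sum fun W hW => ?_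
          obtain ⟨hWΛ, -, hd⟩ := Finset.mem_filter.1 hW
          obtain ⟨x, hx, -⟩ := Finset.not_disjoint_iff.1 hd
          exact hn W (Finset.mem_powerset.1 hWΛ) ⟨x, hx⟩ _ (hΦ.even W r (hI hr)) r hr
      _ = 2 * ‖B‖ * ∑ W ∈ crossingSets Λ X, ‖Φ W r‖ * ∑ z ∈ W, f z := by
          rw [Finset.mul_sum]
          exact Finset.sum_congr rfl fun W _ => by ring
      _ ≤ 2 * ‖B‖ * (φ r * ∑ x ∈ D, ∑ z ∈ Λ, G x z * f z) := by
          gcongr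
          exact sum_mul_sum_le_of_meets hD (crossingSets_subset Λ X) (fun _ => norm_nonneg _) hf0
            (fun W hW h => exists_mem_interactionBoundary hW (hI hr) (norm_ne_zero_iff.1 h))
            (hφ r hr)
      _ ≤ 2 * ‖B‖ * (φ r * ∑ x ∈ D, (∑ y ∈ Y, G x y + approxProfile G Λ Y c n (p r) x)) := by
          have := hφ0 r
          gcongr
          exact hconv _
      _ = _ := by rw [← Finset.sum_mul]; ring

-- Induction on the order of the profile. The indicator of `Y` absorbs the case where `W` meets `Y`,
-- in which only the trivial bound is used; if `W` and `Y` are disjoint, evenness makes `C` and `B`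
-- commute and the iteration applies.
open scoped Classical in
theorem norm_commutator_heisenberg_even_le (hG : IsDecayFunction G)
    (hΦ : IsEvenInteraction I Φ) (hU : IsPropagator I Φ Λ U) {Y : Finset Γ} (hY : Y ⊆ Λ)
    {B : FockOp Γ} (hB : B ∈ carAlgebra (Y : Set Γ)) {s t : ℝ} (hs : s ∈ I) (hI : Icc s t ⊆ I)
    {φ : ℝ → ℝ} (hφc : Continuous φ) (hφ0 : ∀ r, 0 ≤ φ r)
    (hφ : ∀ r ∈ Icc s t, ∀ x ∈ Λ, ∀ z ∈ Λ,
      ∑ W ∈ Λ.powerset with x ∈ W ∧ z ∈ W, ‖Φ W r‖ ≤ φ r * G x z) {c : ℝ}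
    (hc : ∀ z ∈ Λ, 1 ≤ c * G z z) (hc0 : 0 ≤ c) (n : ℕ) :
    ∀ W ⊆ Λ, W.Nonempty → ∀ C ∈ evenPart W, ∀ r ∈ Icc s t,
      ‖heisenberg U r s C * B - B * heisenberg U r s C‖ ≤ 2 * ‖C‖ * ‖B‖ *
        ∑ z ∈ W, ((if z ∈ Y then 1 else 0) +
          approxProfile G Λ Y c n (2 * ∫ q in s..r, φ q) z) := by
  have hp0 : ∀ r, s ≤ r → 0 ≤ 2 * ∫ q in s..r, φ q := fun r hr =>
    mul_nonneg zero_le_two (intervalIntegral.integral_nonneg hr fun q _ => hφ0 q)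
  have hind : ∀ z, (0 : ℝ) ≤ if z ∈ Y then 1 else 0 := fun z => by split_ifs <;> norm_num
  have hsum : ∀ (S : Finset Γ) z, 0 ≤ ∑ y ∈ S, G z y := fun S z =>
    Finset.sum_nonneg fun y _ => (hG.pos z y).le
  have trivial_bound : ∀ n, ∀ W : Finset Γ, ∀ C : FockOp Γ, ∀ r ∈ Icc s t,
      (∃ z ∈ W, 1 ≤ (if z ∈ Y then 1 else 0) +
        approxProfile G Λ Y c n (2 * ∫ q in s..r, φ q) z) →
      ‖heisenberg U r s C * B - B * heisenberg U r s C‖ ≤ 2 * ‖C‖ * ‖B‖ *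
        ∑ z ∈ W, ((if z ∈ Y then 1 else 0) +
          approxProfile G Λ Y c n (2 * ∫ q in s..r, φ q) z) := by
    rintro n W C r hr ⟨z, hz, h⟩
    refine (norm_commutator_heisenberg_le hU hΦ hs hI hr C B).trans ?_
    refine le_mul_of_one_le_right (by positivity) (h.trans ?_)
    exact Finset.single_le_sum (f := fun z => (if z ∈ Y then (1 : ℝ) else 0) +
      approxProfile G Λ Y c n (2 * ∫ q in s..r, φ q) z) (fun z _ =>
      add_nonneg (hind z) (approxProfile_nonneg hG _ _ hc0 _ (hp0 r hr.1) z)) hz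
  induction n with
  | zero =>
    rintro W hW ⟨z, hz⟩ C - r hr
    -- At order `0` the error term is at least `c * G z z ≥ 1`, which is enough for the trivial
    -- bound; this is where `W` must be nonempty.
    refine trivial_bound 0 W C r hr ⟨z, hz, ?_⟩
    have h1 : 0 ≤ Real.exp (2 * ∫ q in s..r, φ q) - 1 := by
      linarith [Real.one_le_exp (hp0 r hr.1)]
    have h2 : G z z ≤ ∑ y ∈ Λ, G z y :=
      Finset.single_le_sum (f := fun y => G z y) (fun y _ => (hG.pos z y).le) (hW hz)
    have h3 := mul_nonneg h1 (hsum Y z)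
    have h4 := mul_le_mul_of_nonneg_left h2 hc0
    have h5 := hc z (hW hz)
    have h6 := hind z
    simp only [approxProfile, pow_zero, Nat.factorial_zero, Nat.cast_one, div_one, mul_one]
    linarith
  | succ n ih =>
    intro W hW hWn C hC r hr
    by_cases hd : Disjoint W Y
    · have hIr : Icc s r ⊆ Icc s t := Icc_subset_Icc_right hr.2
      have hcomm := (commute_of_mem_evenPart (Finset.disjoint_coe.2 hd) hC hB).eq
      have := norm_twisted_heisenberg_le_approxProfile hG hΦ hU hW hY hd hC.1 hB (σ := -1)
        (by simp) (by simp [hcomm]) hs (hIr.trans hI) hr.1 hφc hφ0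
        (fun q hq => hφ q (hIr hq)) hc0
        (fun W' hW' hn' C' hC' q hq => ih W' hW' hn' C' hC' q (hIr hq))
      rw [neg_one_smul, ← sub_eq_add_neg] at this
      refine this.trans ?_
      gcongr ?_ * ?_
      refine (Finset.sum_le_sum_of_subset_of_nonneg (interactionBoundary_subset I Φ W)
        fun z _ _ => approxProfile_nonneg hG _ _ hc0 _ (hp0 r hr.1) z).trans ?_
      exact Finset.sum_le_sum fun z _ => le_add_of_nonneg_left (hind z)
    · obtain ⟨z, hzW, hzY⟩ := Finset.not_disjoint_iff.1 hd
      refine trivial_bound (n + 1) W C r hr ⟨z, hzW, ?_⟩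
      rw [if_pos hzY]
      exact le_add_of_nonneg_right (approxProfile_nonneg hG _ _ hc0 _ (hp0 r hr.1) z)

theorem tendsto_approxProfile (G : Γ → Γ → ℝ) (Λ Y : Finset Γ) (c p : ℝ) (z : Γ) :
    Filter.Tendsto (fun n => approxProfile G Λ Y c n p z) Filter.atTop
      (nhds ((Real.exp p - 1) * ∑ y ∈ Y, G z y)) := by
  have h := ((FloorSemiring.tendsto_pow_div_factorial_atTop p).const_mul c).mul_const
    (∑ y ∈ Λ, G z y)
  simpa [approxProfile] using h.const_add ((Real.exp p - 1) * ∑ y ∈ Y, G z y)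

theorem norm_twisted_heisenberg_le_exp (hG : IsDecayFunction G)
    (hΦ : IsEvenInteraction I Φ) {ψ : ℝ → ℝ} (hψ : IsInteractionNorm I G Φ ψ)
    (hU : IsPropagator I Φ Λ U) {X Y : Finset Γ} (hX : X ⊆ Λ)
    (hY : Y ⊆ Λ) (hXY : Disjoint X Y) {A B : FockOp Γ} (hA : A ∈ carAlgebra (X : Set Γ))
    (hB : B ∈ carAlgebra (Y : Set Γ)) {σ : ℂ} (hσ : ‖σ‖ ≤ 1) (hAB : A * B + σ • (B * A) = 0)
    {s t : ℝ} (hs : s ∈ I) (hI : Icc s t ⊆ I) (hst : s ≤ t) :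
    ‖heisenberg U t s A * B + σ • (B * heisenberg U t s A)‖ ≤
      2 * ‖A‖ * ‖B‖ * (Real.exp (2 * ∫ r in s..t, ψ r) - 1) *
        ∑ x ∈ interactionBoundary I Φ X, ∑ y ∈ Y, G x y := by
  classical
  obtain ⟨φ, hφc, hφ0, hφψ, hφ⟩ :=
    exists_continuous_interactionNorm_minorant hG hΦ hψ Λ hst hI
  -- Any constant with `c * G z z ≥ 1` on `Λ` would do; its dependence on `Λ` disappears in the
  -- limit.
  set c := ∑ z ∈ Λ, (G z z)⁻¹ with hcdef
  have hc0 : 0 ≤ c := Finset.sum_nonneg fun z _ => (inv_pos.2 (hG.pos z z)).le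
  have hc : ∀ z ∈ Λ, 1 ≤ c * G z z := fun z hz => by
    rw [← div_le_iff₀ (hG.pos z z), one_div]
    exact Finset.single_le_sum (f := fun z => (G z z)⁻¹)
      (fun z _ => (inv_pos.2 (hG.pos z z)).le) hz
  have hn := fun n => norm_twisted_heisenberg_le_approxProfile hG hΦ hU hX hY hXY hA hB hσ hAB hs
    hI hst hφc hφ0 hφ hc0 (norm_commutator_heisenberg_even_le hG hΦ hU hY hB hs hI hφc hφ0 hφ
      hc hc0 n)
  have hlim := (tendsto_finsetSum (interactionBoundary I Φ X) fun x _ =>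
    (tendsto_approxProfile G Λ Y c (2 * ∫ q in s..t, φ q) x).comp
      (Filter.tendsto_add_atTop_nat 1)).const_mul (2 * ‖A‖ * ‖B‖)
  have hle := ge_of_tendsto' hlim hn
  refine hle.trans ?_
  -- The estimate obtained with `φ` is weakened to the given `ψ` by monotonicity of the exponential.
  have hint : ∫ q in s..t, φ q ≤ ∫ q in s..t, ψ q := by
    refine intervalIntegral.integral_mono_on hst (hφc.intervalIntegrable _ _) ?_ hφψ
    rw [intervalIntegrable_iff_integrableOn_Icc_of_le hst]
    exact (hψ.locallyIntegrableOn.mono_set hI).integrableOn_isCompact isCompact_Icc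
  have hsum : 0 ≤ ∑ x ∈ interactionBoundary I Φ X, ∑ y ∈ Y, G x y :=
    Finset.sum_nonneg fun x _ => Finset.sum_nonneg fun y _ => (hG.pos x y).le
  rw [← Finset.mul_sum, ← mul_assoc]
  gcongr

end LiebRobinson

theorem theorem3p1 {Γ : Type*} [Countable Γ] [MetricSpace Γ]
    (I : Set ℝ) (hI : I.OrdConnected)
    (G : Γ → Γ → ℝ) (hG : IsDecayFunction G)
    (Φ : Finset Γ → ℝ → FockOp Γ) (hΦ : Φ ∈ decayingInteractions I G)
    (normΦ : ℝ → ℝ) (hnormΦ : IsInteractionNorm I G Φ normΦ)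
    (Λ : Finset Γ) (U : ℝ → ℝ → FockOp Γ) (hU : IsPropagator I Φ Λ U)
    (X Y : Finset Γ) (hX : X ⊆ Λ) (hY : Y ⊆ Λ) (hXY : Disjoint X Y)
    (A B : FockOp Γ) (hA : A ∈ carAlgebra (X : Set Γ)) (hB : B ∈ carAlgebra (Y : Set Γ)) :
    (A * B - B * A = 0 → ∀ s ∈ I, ∀ t ∈ I, s ≤ t →
      ‖heisenberg U t s A * B - B * heisenberg U t s A‖ ≤
        2 * ‖A‖ * ‖B‖ * (Real.exp (2 * ∫ r in s..t, normΦ r) - 1) *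
          ∑ x ∈ interactionBoundary I Φ X, ∑ y ∈ Y, G x y) ∧
    (A * B + B * A = 0 → ∀ s ∈ I, ∀ t ∈ I, s ≤ t →
      ‖heisenberg U t s A * B + B * heisenberg U t s A‖ ≤
        2 * ‖A‖ * ‖B‖ * (Real.exp (2 * ∫ r in s..t, normΦ r) - 1) *
          ∑ x ∈ interactionBoundary I Φ X, ∑ y ∈ Y, G x y) := by
  constructor
  · intro hAB s hs t ht hst
    have := norm_twisted_heisenberg_le_exp hG hΦ.1 hnormΦ hU hX hY hXY hA hB (σ := -1) (by simp)
      (by rwa [neg_one_smul, ← sub_eq_add_neg]) hs (hI.out hs ht) hst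
    rwa [neg_one_smul, ← sub_eq_add_neg] at this
  · intro hAB s hs t ht hst
    have := norm_twisted_heisenberg_le_exp hG hΦ.1 hnormΦ hU hX hY hXY hA hB (σ := 1) (by simp)
      (by rwa [one_smul]) hs (hI.out hs ht) hst
    rwa [one_smul] at this
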